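/- Let $(\mathbb X,d)$ be a locally compact metric space, $T>0$, and $E\colon[0,T]\times\mathbb X\to\mathbb R$. Write $|\partial E_t|(x)=\limsup_{x'\to x}\frac{(E_t(x)-E_t(x'))^+}{d(x,x')}$ for the slope, $|\dot\phi|$ for the metric derivative of a curve, and $AC([a,b];\mathbb X)$ for the absolutely continuous curves. Assume: (1) $E$ is continuous, differentiable in $t$ with $\partial_tE$ continuous on $[0,T]\times\mathbb X$, and $(t,x)\mapsto|\partial E_t|(x)$ is finite and continuous on $[0,T]\times\mathbb X$. (2) There are $C_1,C_2>0$ with $|\partial_tE_t(x)|\le C_1E_t(x)+C_2$ for all $(t,x)\in[0,T]\times\mathbb X$. (3) The sets $\{x: \sup_{t\in[0,T]}|E_t(x)|\le C\}$, $C\in\mathbb R$, are compact. (4) For every $t\in[0,T]$ the set $\{|\partial E_t|=0\}$ is a disjoint union of compact sets, each at positive distance from the union of the others and each such that any two of its points are joined by a rectifiable path inside it; and $E_t$ is constant on every path component of $\{|\partial E_t|=0\}$. (5) $d(x,x')=\inf\{\int_0^1|\dot\eta|\,ds:\eta\in AC([0,1];\mathbb X),\ \eta(0)=x,\ \eta(1)=x'\}$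 for all $x,x'\in\mathbb X$, and there is $L>0$ such that $x\mapsto|\partial E_t|(x)$ is $L$-Lipschitz for every $t\in[0,T]$. The action of the gradient flow is $$c^F_t(x_1,x_2)=\inf\Big\{\tfrac12\int_a^b\big(|\partial E_t|^2(\phi(s))+|\dot\phi|^2(s)\big)ds:\ a<b,\ \phi\in AC([a,b];\mathbb X),\ \phi(a)=x_1,\ \phi(b)=x_2\Big\}.$$ A transition rule of the gradient flow is a family of maps $\bar\omega_t\colon\mathbb X\to\mathbb X$, $t\in[0,T]$, such that for all $t$ and $x$ there are a curve $\phi\colon[0,\infty)\to\mathbb X$, absolutely continuous on every $[0,s]$, with $\phi(0)=x$, and $s_k\nearrow\infty$ with $\phi(s_k)\to\bar\omega_t(x)$ and, for all $s\ge0$, $E_t(x)-E_t(\phi(s))=\frac12\int_0^s\big(|\partial E_t|^2(\phi)+|\dot\phi|^2\big)d\sigma$. **Claim.** $c^F$ is an action, i.e. for every $t\in[0,T]$ the function $c^F_t\colon\mathbb X\times\mathbb X\to[0,\infty)$ is finite, lower semicontinuous, and satisfies $E_t(x)-E_t(x')\le c^F_t(x,x')$. Every transition rule $\bar\omega$ of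 the gradient flow is compatible with it: $E_t(x)-E_t(\bar\omega_t(x))=c^F_t(x,\bar\omega_t(x))$ for all $t\in[0,T]$, $x\in\mathbb X$. Moreover $c^F$ is generated by curves, with the following data: index set $\mathbb R$ with Lebesgue measure, phase space $\mathscr P=\mathbb X\times[0,\infty)$ with metric $d(x_1,x_2)+|v_1-v_2|$, embedding $i(x)=(x,0)$, price $\mathcal L_t(x,v)=\frac12|\partial E_t|^2(x)+\frac12v^2$, and the set $\Gamma(p_1,p_2)$ of admissible curves consisting of all $\gamma=(\gamma_x,\gamma_v)\colon[a,b]\to\mathscr P$ with $a<b$, $\gamma(a)=p_1$, $\gamma(b)=p_2$, $\gamma_x\in AC([a,b];\mathbb X)$ and $|\dot\gamma_x|=\gamma_v$ a.e. That is, with $\mathfrak c_t(p_1,p_2)=\inf_{\gamma\in\Gamma(p_1,p_2)}\int_a^b\mathcal L_t(\gamma(s))\,ds$: the map $i$ is a closed embedding, $(p,t)\mapsto\mathcal L_t(p)$ is continuous on $\mathscr P\times[0,T]$, $c^F_t(x_1,x_2)=\mathfrak c_t(i(x_1),i(x_2))$ for all $t\in[0,T]$ and $x_1,x_2\in\mathbb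 X$, and (P1) restrictions of admissible curves to nondegenerate subintervals having one endpoint in common with the domain, concatenations, and time shifts of admissible curves are admissible (between the corresponding endpoints); (P2) for all $t\in[0,T]$ and $p\in\mathscr P$, $\mathcal L_t(p)=0$ if and only if $p=i(x)$ for some $x$ with $|\partial E_t|(x)=0$; (P3) for all $t\in[0,T]$ and $x_1\ne x_2$, $c^F_t(x_1,x_2)=0$ if and only if $i(x_1)$ and $i(x_2)$ lie in the same connected component of $\{\mathcal L_t=0\}$; (P4) for every compact $K\subseteq\mathscr P$ there is a compact $K'\subseteq\mathscr P$ such that for all $t\in[0,T]$, $p_1,p_2\in K$ and $\varepsilon>0$ there is $\gamma\in\Gamma(p_1,p_2)$ with image in $K'$ and $\int_a^b\mathcal L_t(\gamma)\,ds\le\mathfrak c_t(p_1,p_2)+\varepsilon$; (P5) for every compact $K\subseteq\mathscr P$ and $\varepsilon>0$ there are $\ell,P>0$ such that $\mathfrak c_t(p_1,p_2)\le\varepsilon$ for all $t\in[0,T]$ and $p_1,p_2\in K$ with $\mathcal L_t(p_1)\le P$, $\mathcal L_t(p_2)\le P$ and $d_{\mathscr P}(p_1,p_2)\le\ell$. 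-/

import Mathlib

open Set Filter Topology MeasureTheory
open scoped ENNReal NNReal

noncomputable section

namespace QuasistaticEvolution

/-! ### Metric notions -/

/-- The (descending) slope `|∂f|(x) = limsup_{y → x} (f x - f y)⁺ / d(x, y)`, with values in
`[0, ∞]`; it is `0` at isolated points. -/
def descSlope {X : Type*} [MetricSpace X] (f : X → ℝ) (x : X) : ℝ≥0∞ :=
  limsup (fun y => ENNReal.ofReal (f x - f y) / edist x y) (𝓝[≠] x)

/-- The metric derivative `|φ̇|(s) = limsup_{r → s} d(φ r, φ s) / |r - s|`. For an absolutely
continuous curve the limsup is a finite limit at almost every `s`. Whenever it is used for a curve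
on `[a, b]`, only its values at almost every point of `[a, b]` matter, and at interior points these
depend on the curve inside `[a, b]` only. -/
def metricSpeed {X : Type*} [MetricSpace X] (φ : ℝ → X) (s : ℝ) : ℝ≥0∞ :=
  limsup (fun r => edist (φ r) (φ s) / edist r s) (𝓝[≠] s)

/-- The metric length `∫_a^b |φ̇|(s) ds`. -/
def metricLength {X : Type*} [MetricSpace X] (φ : ℝ → X) (a b : ℝ) : ℝ≥0∞ :=
  ∫⁻ s in Ioc a b, metricSpeed φ s

/-- The set of critical points of `f`. -/
def criticalSet {X : Type*} [MetricSpace X] (f : X → ℝ) : Set X :=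
  {x | descSlope f x = 0}

/-! ### Standing assumptions on the space and on the energy `E : [0, T] × X → ℝ`

The energy is a function `E : ℝ → X → ℝ` of which only the restriction to `[0, T] × X` is used. -/

/-- `E` is continuous and differentiable in time with continuous time derivative, and its slope is a
finite continuous function on `[0, T] × X`. -/
structure RegularEnergy {X : Type*} [MetricSpace X] (T : ℝ) (E : ℝ → X → ℝ) : Prop where
  continuousOn : ContinuousOn (fun q : ℝ × X => E q.1 q.2) (Icc 0 T ×ˢ univ)
  differentiable : ∀ x, DifferentiableOn ℝ (fun t => E t x) (Icc 0 T)
  continuousOn_deriv :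
    ContinuousOn (fun q : ℝ × X => derivWithin (fun t => E t q.2) (Icc 0 T) q.1) (Icc 0 T ×ˢ univ)
  slope_ne_top : ∀ t ∈ Icc 0 T, ∀ x, descSlope (E t) x ≠ ∞
  continuousOn_slope :
    ContinuousOn (fun q : ℝ × X => descSlope (E q.1) q.2) (Icc 0 T ×ˢ univ)

/-- `|∂ₜ E_t(x)| ≤ C₁ E_t(x) + C₂`. -/
def PowerControl {X : Type*} [MetricSpace X] (T : ℝ) (E : ℝ → X → ℝ) : Prop :=
  ∃ C₁ C₂ : ℝ, 0 < C₁ ∧ 0 < C₂ ∧ ∀ t ∈ Icc 0 T, ∀ x,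
    |derivWithin (fun s => E s x) (Icc 0 T) t| ≤ C₁ * E t x + C₂

/-- The sublevel sets of `G x = sup_{t ∈ [0, T]} |E_t(x)|` are compact. -/
def UniformlyCoercive {X : Type*} [MetricSpace X] (T : ℝ) (E : ℝ → X → ℝ) : Prop :=
  ∀ C : ℝ, IsCompact {x : X | (⨆ t : Icc (0 : ℝ) T, |E t x|) ≤ C}

/-- Any two points of `A` are joined by a rectifiable path inside `A`. -/
def RectifiablyPathConnected {X : Type*} [MetricSpace X] (A : Set X) : Prop :=
  ∀ x ∈ A, ∀ y ∈ A, ∃ η : ℝ → X, ContinuousOn η (Icc 0 1) ∧ MapsTo η (Icc 0 1) A ∧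
    η 0 = x ∧ η 1 = y ∧ eVariationOn η (Icc 0 1) ≠ ∞

/-- For every `t`, the critical set of `E_t` is a disjoint union of well-separated compact sets (each
of them has a positive distance from the union of the others) that are path-connected with
rectifiable paths, and `E_t` is constant on the path components of the critical set. -/
def CriticalComponents {X : Type*} [MetricSpace X] (T : ℝ) (E : ℝ → X → ℝ) : Prop :=
  ∀ t ∈ Icc 0 T,
    (∃ 𝒞 : Set (Set X), ⋃₀ 𝒞 = criticalSet (E t) ∧ 𝒞.PairwiseDisjoint id ∧
      (∀ A ∈ 𝒞, IsCompact A ∧ RectifiablyPathConnected A) ∧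
      (∀ A ∈ 𝒞, ∃ r > 0, ∀ B ∈ 𝒞, B ≠ A → ∀ x ∈ A, ∀ y ∈ B, r ≤ dist x y)) ∧
    ∀ x y, JoinedIn (criticalSet (E t)) x y → E t x = E t y

/-- The distance is the infimum of the lengths of absolutely continuous curves. -/
def IsPathMetric (X : Type*) [MetricSpace X] : Prop :=
  ∀ x y : X, edist x y =
    ⨅ (η : ℝ → X) (_ : AbsolutelyContinuousOnInterval η 0 1 ∧ η 0 = x ∧ η 1 = y),
      metricLength η 0 1

/-- The slope is Lipschitz continuous in space, uniformly in time. -/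
def SlopeLipschitz {X : Type*} [MetricSpace X] (T : ℝ) (E : ℝ → X → ℝ) : Prop :=
  ∃ L : ℝ, 0 < L ∧ ∀ t ∈ Icc 0 T, ∀ x y,
    |(descSlope (E t) x).toReal - (descSlope (E t) y).toReal| ≤ L * dist x y

/-! ### Actions, compatibility, generation by curves -/

/-- An action: a family of lower semicontinuous functions `c_t : X × X → [0, ∞)`, `t ∈ [0, T]`,
with `E_t(x) - E_t(x') ≤ c_t(x, x')`. -/
structure IsAction {X : Type*} [MetricSpace X] (T : ℝ) (E : ℝ → X → ℝ)
    (c : ℝ → X → X → ℝ≥0∞) : Prop where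
  ne_top : ∀ t ∈ Icc 0 T, ∀ x y, c t x y ≠ ∞
  lowerSemicontinuous : ∀ t ∈ Icc 0 T, LowerSemicontinuous (fun q : X × X => c t q.1 q.2)
  energy_le : ∀ t ∈ Icc 0 T, ∀ x y, E t x - E t y ≤ (c t x y).toReal

/-- The transition rule `ω` is compatible with the action `c`. -/
def IsCompatible {X : Type*} [MetricSpace X] (T : ℝ) (E : ℝ → X → ℝ)
    (c : ℝ → X → X → ℝ≥0∞) (ω : ℝ → X → X) : Prop :=
  IsAction T E c ∧
    ∀ t ∈ Icc 0 T, ∀ x, E t x - E t (ω t x) = (c t x (ω t x)).toReal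

/-- The action on phase space: the infimum of `∫_{(a, b]} 𝓛_t(γ_s) dν(s)` over all admissible curves
`γ : [a, b] → P` from `p₁` to `p₂`. Here `γ ∈ Γ p₁ p₂ a b` says that the restriction of `γ` to
`[a, b]` is an admissible curve. -/
def phaseAction {I P : Type*} [LinearOrder I] [MeasurableSpace I] (ν : Measure I)
    (Γ : P → P → I → I → Set (I → P)) (𝓛 : ℝ → P → ℝ≥0) (t : ℝ) (p₁ p₂ : P) : ℝ≥0∞ :=
  ⨅ (a : I) (b : I) (γ : I → P) (_ : γ ∈ Γ p₁ p₂ a b), ∫⁻ s in Ioc a b, (𝓛 t (γ s) : ℝ≥0∞) ∂ν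

/-- The action `c` is generated by curves with index set `I` and measure `ν` (one takes either `ℝ`
with Lebesgue measure or `ℤ` with counting measure), phase space `P`, admissible curves `Γ`,
embedding `i` and price `𝓛`. A curve `[a, b] → P` is given by a function on all of `I`, of which
only the values on `[a, b]` count (`congr`). -/
structure IsGeneratedByCurves {X : Type*} [MetricSpace X] (T : ℝ) (E : ℝ → X → ℝ)
    (c : ℝ → X → X → ℝ≥0∞)
    {I : Type*} [AddCommGroup I] [LinearOrder I] [MeasurableSpace I] (ν : Measure I)
    {P : Type*} [MetricSpace P] (Γ : P → P → I → I → Set (I → P)) (i : X → P)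
    (𝓛 : ℝ → P → ℝ≥0) : Prop where
  isAction : IsAction T E c
  lt : ∀ p₁ p₂ a b γ, γ ∈ Γ p₁ p₂ a b → a < b
  congr : ∀ p₁ p₂ a b γ γ', EqOn γ γ' (Icc a b) → γ ∈ Γ p₁ p₂ a b → γ' ∈ Γ p₁ p₂ a b
  endpoints : ∀ p₁ p₂ a b γ, γ ∈ Γ p₁ p₂ a b → γ a = p₁ ∧ γ b = p₂
  isClosedEmbedding : IsClosedEmbedding i
  continuousOn_price : ContinuousOn (fun q : P × ℝ => 𝓛 q.2 q.1) (univ ×ˢ Icc 0 T)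
  action_eq : ∀ t ∈ Icc 0 T, ∀ x₁ x₂, c t x₁ x₂ = phaseAction ν Γ 𝓛 t (i x₁) (i x₂)
  /-- Restrictions. -/
  restriction : ∀ p₁ p₂ p₃ a s b γ, γ ∈ Γ p₁ p₃ a b → a < s → s < b → γ s = p₂ →
    γ ∈ Γ p₁ p₂ a s ∧ γ ∈ Γ p₂ p₃ s b
  /-- Concatenations. -/
  concatenation : ∀ p₁ p₂ p₃ a s b γ γ', γ ∈ Γ p₁ p₂ a s → γ' ∈ Γ p₂ p₃ s b →
    (fun r => if r ≤ s then γ r else γ' r) ∈ Γ p₁ p₃ a b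
  /-- Shifts. -/
  shift : ∀ p₁ p₂ a b r γ, γ ∈ Γ p₁ p₂ a b → (fun s => γ (s + r)) ∈ Γ p₁ p₂ (a - r) (b - r)
  /-- The price vanishes exactly on the embedded critical points. -/
  price_eq_zero_iff : ∀ t ∈ Icc 0 T, ∀ p,
    𝓛 t p = 0 ↔ ∃ x, i x = p ∧ descSlope (E t) x = 0
  /-- The action vanishes exactly within the connected components of the zero set of the price. -/
  action_eq_zero_iff : ∀ t ∈ Icc 0 T, ∀ x₁ x₂, x₁ ≠ x₂ →
    (c t x₁ x₂ = 0 ↔ i x₂ ∈ connectedComponentIn {p | 𝓛 t p = 0} (i x₁))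
  /-- Between points of a compact set, almost optimal curves can be chosen in a compact set, which
  does not depend on time. -/
  coercive : ∀ K : Set P, IsCompact K → ∃ K' : Set P, IsCompact K' ∧
    ∀ t ∈ Icc 0 T, ∀ p₁ ∈ K, ∀ p₂ ∈ K, ∀ ε : ℝ≥0, 0 < ε →
      ∃ a b γ, γ ∈ Γ p₁ p₂ a b ∧ γ '' Icc a b ⊆ K' ∧
        ∫⁻ s in Ioc a b, (𝓛 t (γ s) : ℝ≥0∞) ∂ν ≤ phaseAction ν Γ 𝓛 t p₁ p₂ + ε
  /-- The action is small between nearby points at which the price is small. -/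
  cheap : ∀ K : Set P, IsCompact K → ∀ ε : ℝ≥0, 0 < ε → ∃ L : ℝ, ∃ Q : ℝ≥0, 0 < L ∧ 0 < Q ∧
    ∀ t ∈ Icc 0 T, ∀ p₁ ∈ K, ∀ p₂ ∈ K, 𝓛 t p₁ ≤ Q → 𝓛 t p₂ ≤ Q → dist p₁ p₂ ≤ L →
      phaseAction ν Γ 𝓛 t p₁ p₂ ≤ ε

/-! ### The gradient flow -/

/-- `½ ∫_a^b (|∂E_t|²(φ(s)) + |φ̇(s)|²) ds`. -/
def gfDissipation {X : Type*} [MetricSpace X] (E : ℝ → X → ℝ) (t : ℝ) (φ : ℝ → X) (a b : ℝ) :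
    ℝ≥0∞ :=
  2⁻¹ * ∫⁻ s in Ioc a b, (descSlope (E t) (φ s) ^ 2 + metricSpeed φ s ^ 2)

/-- The action of the gradient flow. -/
def gfAction {X : Type*} [MetricSpace X] (E : ℝ → X → ℝ) (t : ℝ) (x₁ x₂ : X) : ℝ≥0∞ :=
  ⨅ (a : ℝ) (b : ℝ) (φ : ℝ → X)
    (_ : a < b ∧ AbsolutelyContinuousOnInterval φ a b ∧ φ a = x₁ ∧ φ b = x₂),
      gfDissipation E t φ a b

/-- A transition rule of the gradient flow: `ω t x` is a limit point as `s → ∞` of a curve `φ` that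
starts at `x`, is absolutely continuous on every `[0, s]`, and satisfies
`E_t(x) - E_t(φ(s)) = ½ ∫_0^s (|∂E_t|²(φ) + |φ̇|²)` for all `s ≥ 0`. -/
def IsGFTransitionRule {X : Type*} [MetricSpace X] (T : ℝ) (E : ℝ → X → ℝ) (ω : ℝ → X → X) :
    Prop :=
  ∀ t ∈ Icc 0 T, ∀ x, ∃ (φ : ℝ → X) (σ : ℕ → ℝ),
    (∀ s, 0 ≤ s → AbsolutelyContinuousOnInterval φ 0 s) ∧
    (∀ k, 0 ≤ σ k) ∧ Monotone σ ∧ Tendsto σ atTop atTop ∧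
    φ 0 = x ∧ Tendsto (fun k => φ (σ k)) atTop (𝓝 (ω t x)) ∧
    ∀ s, 0 ≤ s → gfDissipation E t φ 0 s ≠ ∞ ∧
      E t x - E t (φ s) = (gfDissipation E t φ 0 s).toReal

/-- The phase space `X × [0, ∞)` with the metric `d(x₁, x₂) + |v₁ - v₂|`. -/
abbrev GFPhase (X : Type*) : Type _ := WithLp 1 (X × ℝ≥0)

/-- The embedding `x ↦ (x, 0)`. -/
def gfEmbedding {X : Type*} (x : X) : GFPhase X := WithLp.toLp 1 (x, 0)

/-- The admissible curves: the first component is absolutely continuous, and its metric derivative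
is almost everywhere the second component. -/
def gfCurves {X : Type*} [MetricSpace X] (p₁ p₂ : GFPhase X) (a b : ℝ) : Set (ℝ → GFPhase X) :=
  {γ | a < b ∧ γ a = p₁ ∧ γ b = p₂ ∧ AbsolutelyContinuousOnInterval (fun s => (γ s).fst) a b ∧
    ∀ᵐ s ∂(volume.restrict (Ioc a b)), metricSpeed (fun r => (γ r).fst) s = ((γ s).snd : ℝ≥0∞)}

/-- The price `½ |∂E_t|²(x) + ½ v²`. -/
def gfPrice {X : Type*} [MetricSpace X] (E : ℝ → X → ℝ) (t : ℝ) (p : GFPhase X) : ℝ≥0 :=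
  2⁻¹ * (descSlope (E t) p.fst).toNNReal ^ 2 + 2⁻¹ * p.snd ^ 2

end QuasistaticEvolution

end

/-!
# Variational action of a gradient flow

Write `g = |∂E_t|` for the slope and `c_t` for the action. The idea is that only the geometric part
of the action matters: `½ (g² + v²) ≥ g v`, with equality for speed `v = g`, so that
`c_t(x, y)` is the infimum of `∫ g(φ) |φ̇|` over curves `φ` of finite length from `x` to `y`.

The inequality that is not immediate is proved by a time change. For a curve `φ` of finite length
and `ρ = g + δ`, the new time is the primitive of `|φ̇| / ρ(φ) + κ`; it is a homeomorphism, it turns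
its density into Lebesgue measure, and the reparametrized curve `ψ` has speed at most `ρ(ψ)`
(`exists_reparametrization`). As `δ` and `κ` tend to `0`, its action tends to `∫ g(φ) |φ̇|`
(`exists_almost_optimal_reparametrization`). The time change has three consequences.

* *Lower bounds.* If `f` is continuous and its slope is at most `g`, then `f(x) - f(y) ≤ c_t(x, y)`
  (`ofReal_sub_le_gfAction`): along `ψ`, the one-sided difference quotients of `-f` are at most
  `ρ(ψ)²`. For `f = E_t` this is the energy inequality. For a truncated distance function it says
  that crossing a layer of width `w` on which `g ≥ δ` costs at least `δ w`
  (`ofReal_mul_le_gfAction`).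
* *Upper bounds.* As `d` is a length distance and `g` is `L`-Lipschitz, almost shortest curves give
  `c_t(x, y) ≤ (g(x) + L d(x, y)) d(x, y)` (`gfAction_le_mul_dist`). Hence `c_t` is finite, it is
  lower semicontinuous by the triangle inequality, and it is small between nearby points of small
  price. Between nearby critical points it is quadratic in the distance, so that subdividing a
  rectifiable path of critical points shows that its end points have zero action
  (`gfAction_eq_zero_of_rectifiablyPathConnected`).
* *Compactness.* Near-optimal curves can be taken of speed at most `g + 1`. The energy along a curve
  is at most that of its end point plus the action, and by Gronwall's inequality a bound for the
  energy at one time bounds it at all times, so coercivity confines near-optimal curves to a compact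
  set (`exists_isCompact_near_optimal`). In the same way closed balls are compact
  (`properSpace_of_uniformlyCoercive`), and a compact isolated part of the critical set is
  surrounded by a compact layer on which `g` is bounded below. Together with the layer estimate this
  shows that zero action does not leave a component of the critical set
  (`mem_of_gfAction_eq_zero`).
-/

namespace QuasistaticEvolution

variable {X : Type*} [MetricSpace X]

/-! ### Absolutely continuous curves -/

theorem _root_.AbsolutelyContinuousOnInterval.comp_monotone {Y : Type*} [PseudoMetricSpace Y]
    {f : ℝ → Y} {p : ℝ → ℝ} {a b c d : ℝ}
    (hf : AbsolutelyContinuousOnInterval f a b) (hp : Monotone p) (hp1 : LipschitzWith 1 p)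
    (hmaps : MapsTo p (uIcc c d) (uIcc a b)) :
    AbsolutelyContinuousOnInterval (fun s => f (p s)) c d := by
  rw [absolutelyContinuousOnInterval_iff] at hf ⊢
  intro ε hε
  obtain ⟨δ, hδ, h⟩ := hf ε hε
  refine ⟨δ, hδ, fun J hJ hlen => ?_⟩
  refine h (J.1, fun i => (p (J.2 i).1, p (J.2 i).2)) ⟨fun i hi => ?_, fun i hi j hj hij => ?_⟩ ?_
  · exact ⟨hmaps (hJ.1 i hi).1, hmaps (hJ.1 i hi).2⟩
  · have hdisj := hJ.2 hi hj hij
    simp only [Function.onFun] at hdisj ⊢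
    rw [Set.disjoint_left] at hdisj ⊢
    intro x hx hx'
    simp only [uIoc, ← hp.map_min, ← hp.map_max, mem_Ioc] at hx hx' hdisj
    have h1 := hp.reflect_lt (hx.1.trans_le hx'.2)
    have h2 := hp.reflect_lt (hx'.1.trans_le hx.2)
    have h3 := hp.reflect_lt (hx.1.trans_le hx.2)
    have h4 := hp.reflect_lt (hx'.1.trans_le hx'.2)
    -- If the image intervals meet, then so do the original ones, in the smaller right endpoint.
    exact hdisj (a := min (max (J.2 i).1 (J.2 i).2) (max (J.2 j).1 (J.2 j).2))
      ⟨lt_min h3 h1, min_le_left _ _⟩ ⟨lt_min h2 h4, min_le_right _ _⟩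
  · refine lt_of_le_of_lt (Finset.sum_le_sum fun i _ => ?_) hlen
    simpa using hp1.dist_le_mul (J.2 i).1 (J.2 i).2

theorem _root_.AbsolutelyContinuousOnInterval.comp_lipschitzWith {Y Z : Type*}
    [PseudoMetricSpace Y] [PseudoMetricSpace Z]
    {f : ℝ → Y} {u : Y → Z} {a b : ℝ} (hf : AbsolutelyContinuousOnInterval f a b)
    (hu : LipschitzWith 1 u) : AbsolutelyContinuousOnInterval (fun s => u (f s)) a b :=
  squeeze_zero (fun _ => Finset.sum_nonneg fun _ _ => dist_nonneg)
    (fun _ => Finset.sum_le_sum fun _ _ => by simpa using hu.dist_le_mul _ _) hf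

/-- Continuity of absolutely continuous curves in a metric space. -/
theorem continuousOn_of_absolutelyContinuousOnInterval {φ : ℝ → X} {a b : ℝ}
    (hφ : AbsolutelyContinuousOnInterval φ a b) : ContinuousOn φ (uIcc a b) := by
  intro s hs
  have h := (hφ.comp_lipschitzWith (LipschitzWith.dist_left (φ s))).continuousOn s hs
  rw [ContinuousWithinAt, dist_self] at h
  exact tendsto_iff_dist_tendsto_zero.2 h

theorem _root_.AbsolutelyContinuousOnInterval.congr {Y : Type*} [PseudoMetricSpace Y]
    {f g : ℝ → Y} {a b : ℝ} (hf : AbsolutelyContinuousOnInterval f a b)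
    (h : EqOn f g (uIcc a b)) : AbsolutelyContinuousOnInterval g a b := by
  rw [absolutelyContinuousOnInterval_iff] at hf ⊢
  intro ε hε
  obtain ⟨δ, hδ, h'⟩ := hf ε hε
  refine ⟨δ, hδ, fun J hJ hlen => ?_⟩
  convert! h' J hJ hlen using 1
  refine Finset.sum_congr rfl fun i hi => ?_
  rw [h (hJ.1 i hi).1, h (hJ.1 i hi).2]

theorem _root_.AbsolutelyContinuousOnInterval.trans {Y : Type*} [PseudoMetricSpace Y]
    {f : ℝ → Y} {a s b : ℝ} (has : a ≤ s) (hsb : s ≤ b)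
    (h₁ : AbsolutelyContinuousOnInterval f a s) (h₂ : AbsolutelyContinuousOnInterval f s b) :
    AbsolutelyContinuousOnInterval f a b := by
  -- The increment over an interval splits into the increments of `f (min · s)` and `f (max · s)`.
  have h₁' : AbsolutelyContinuousOnInterval (fun r => f (min r s)) a b := by
    refine h₁.comp_monotone (p := fun r => min r s) (fun x y h => min_le_min_right _ h)
      (LipschitzWith.id.min_const s) fun r hr => ?_
    rw [uIcc_of_le (has.trans hsb)] at hr
    rw [uIcc_of_le has]
    exact ⟨le_min hr.1 has, min_le_right _ _⟩
  have h₂' : AbsolutelyContinuousOnInterval (fun r => f (max r s)) a b := by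
    refine h₂.comp_monotone (p := fun r => max r s) (fun x y h => max_le_max_right _ h)
      (LipschitzWith.id.max_const s) fun r hr => ?_
    rw [uIcc_of_le (has.trans hsb)] at hr
    rw [uIcc_of_le hsb]
    exact ⟨le_max_right _ _, max_le hr.2 hsb⟩
  have key : ∀ x y, dist (f x) (f y) ≤
      dist (f (min x s)) (f (min y s)) + dist (f (max x s)) (f (max y s)) := by
    intro x y
    rcases le_total x s with hx | hx <;> rcases le_total y s with hy | hy <;>
      simp only [min_eq_left, min_eq_right, max_eq_left, max_eq_right, hx, hy, dist_self,
        add_zero, zero_add, le_refl]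
    · exact dist_triangle _ _ _
    · rw [add_comm]; exact dist_triangle _ _ _
  have := Tendsto.add h₁' h₂'
  rw [add_zero] at this
  refine squeeze_zero (fun _ => Finset.sum_nonneg fun _ _ => dist_nonneg) (fun J => ?_) this
  rw [← Finset.sum_add_distrib]
  exact Finset.sum_le_sum fun i _ => key _ _

/-! ### The metric speed -/

theorem metricSpeed_congr {φ ψ : ℝ → X} {s : ℝ} (h : φ =ᶠ[𝓝 s] ψ) :
    metricSpeed φ s = metricSpeed ψ s := by
  refine limsup_congr ?_
  filter_upwards [h.filter_mono nhdsWithin_le_nhds] with r hr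
  rw [hr, h.eq_of_nhds]

theorem metricSpeed_congr_of_mem_Ioo {φ ψ : ℝ → X} {a b s : ℝ} (h : EqOn φ ψ (Icc a b))
    (hs : s ∈ Ioo a b) : metricSpeed φ s = metricSpeed ψ s :=
  metricSpeed_congr (h.eventuallyEq_of_mem (Icc_mem_nhds hs.1 hs.2))

theorem metricSpeed_comp_add_right (φ : ℝ → X) (r s : ℝ) :
    metricSpeed (fun u => φ (u + r)) s = metricSpeed φ (s + r) := by
  have hmap : map (fun u : ℝ => u + r) (𝓝[≠] s) = 𝓝[≠] (s + r) := by simp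
  unfold metricSpeed
  rw [← hmap]
  change _ = limsup _ (map _ _)
  rw [limsup, limsup, map_map]
  simp [Function.comp_def]

theorem ae_restrict_Ioc_of_Ioo {p : ℝ → Prop} {a b : ℝ} (h : ∀ s ∈ Ioo a b, p s) :
    ∀ᵐ s ∂(volume.restrict (Ioc a b)), p s := by
  rw [← restrict_Ioo_eq_restrict_Ioc]
  exact (ae_restrict_iff' measurableSet_Ioo).2 (Eventually.of_forall h)

/-- For a continuous curve, the limsup that defines the metric speed is a countable infimum of
suprema of continuous functions. -/
theorem measurable_metricSpeed {φ : ℝ → X} (hφ : Continuous φ) : Measurable (metricSpeed φ) := by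
  -- For a fixed increment `h`, the difference quotient is continuous in `s`.
  have hq : ∀ h : ℝ, h ≠ 0 → Continuous fun s => edist (φ (s + h)) (φ s) / edist (s + h) s := by
    intro h hh
    have : ∀ s : ℝ, edist (s + h) s = ENNReal.ofReal |h| := by
      intro s; rw [edist_dist, Real.dist_eq, add_sub_cancel_left]
    simp_rw [this]
    exact ENNReal.continuous_div_const _ (by simpa using hh) |>.comp (by fun_prop)
  have hform : metricSpeed φ = fun s => ⨅ n : ℕ, ⨆ h : {h : ℝ // h ≠ 0 ∧ |h| < 1 / (n + 1)},
      edist (φ (s + h)) (φ s) / edist (s + h) s := by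
    ext s
    have hb : (𝓝[≠] s).HasBasis (fun _ : ℕ => True)
        fun n => Metric.ball s (1 / (n + 1)) ∩ {s}ᶜ :=
      nhdsWithin_hasBasis (Metric.nhds_basis_ball_inv_nat_succ) _
    unfold metricSpeed
    rw [hb.limsup_eq_iInf_iSup]
    simp only [iInf_true]
    congr 1
    ext n
    apply le_antisymm
    · refine iSup₂_le fun r hr => ?_
      have hr0 : r - s ≠ 0 := sub_ne_zero.2 hr.2
      have := le_iSup (fun h : {h : ℝ // h ≠ 0 ∧ |h| < 1 / ((n : ℝ) + 1)} =>
        edist (φ (s + h)) (φ s) / edist (s + h) s) ⟨r - s, hr0, hr.1⟩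
      simpa using this
    · refine iSup_le fun h => ?_
      refine le_iSup₂ (f := fun r _ => edist (φ r) (φ s) / edist r s) (s + (h : ℝ)) ⟨?_, ?_⟩
      · simpa [Real.dist_eq] using h.2.2
      · simpa using h.2.1
  rw [hform]
  refine Measurable.iInf fun n => ?_
  exact (lowerSemicontinuous_iSup fun h : {h : ℝ // h ≠ 0 ∧ |h| < 1 / ((n : ℝ) + 1)} =>
    (hq h h.2.1).lowerSemicontinuous).measurable

/-- The increment of an absolutely continuous curve is at most its metric length. -/
theorem edist_le_metricLength {φ : ℝ → X} {a b : ℝ} (hab : a ≤ b)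
    (hφ : AbsolutelyContinuousOnInterval φ a b) : edist (φ a) (φ b) ≤ metricLength φ a b := by
  -- The real function `s ↦ d(φ(a), φ(s))` is absolutely continuous, and its derivative is at most
  -- the metric speed. Where it is not differentiable, `deriv` is zero.
  set h : ℝ → ℝ := fun s => dist (φ a) (φ s) with hh
  have hac : AbsolutelyContinuousOnInterval h a b :=
    hφ.comp_lipschitzWith (LipschitzWith.dist_right (φ a))
  have hderiv : ∀ s, ‖deriv h s‖ₑ ≤ metricSpeed φ s := by
    intro s
    by_cases hd : DifferentiableAt ℝ h s
    · have ht : Tendsto (fun r => ‖slope h s r‖ₑ) (𝓝[≠] s) (𝓝 ‖deriv h s‖ₑ) :=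
        (continuous_enorm.tendsto _).comp (hasDerivAt_iff_tendsto_slope.1 hd.hasDerivAt)
      rw [← ht.limsup_eq]
      refine limsup_le_limsup ?_
      filter_upwards [self_mem_nhdsWithin] with r hr
      rw [slope_def_field, div_eq_mul_inv, enorm_mul, enorm_inv (sub_ne_zero.2 hr),
        ← div_eq_mul_inv, ← edist_eq_enorm_sub, ← edist_eq_enorm_sub]
      gcongr
      simpa using (LipschitzWith.dist_right (φ a)).edist_le_mul (φ r) (φ s)
    · simp [deriv_zero_of_not_differentiableAt hd]
  have hftc := hac.integral_deriv_eq_sub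
  have h0 : h b - h a = dist (φ a) (φ b) := by simp [hh]
  rw [h0, intervalIntegral.integral_of_le hab] at hftc
  calc edist (φ a) (φ b) = ‖dist (φ a) (φ b)‖ₑ := by
        rw [edist_dist, Real.enorm_eq_ofReal dist_nonneg]
    _ ≤ ∫⁻ s in Ioc a b, ‖deriv h s‖ₑ := by
        rw [← hftc]; exact enorm_integral_le_lintegral_enorm _
    _ ≤ metricLength φ a b := lintegral_mono hderiv

/-! ### Time change -/

theorem metricLength_congr {φ ψ : ℝ → X} {a b : ℝ} (h : EqOn φ ψ (Icc a b)) :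
    metricLength φ a b = metricLength ψ a b :=
  lintegral_congr_ae (ae_restrict_Ioc_of_Ioo fun _ hs => metricSpeed_congr_of_mem_Ioo h hs)

theorem metricSpeed_eq_zero_of_const {φ : ℝ → X} {s : ℝ} {x : X} (h : ∀ᶠ r in 𝓝 s, φ r = x) :
    metricSpeed φ s = 0 := by
  rw [metricSpeed_congr (ψ := fun _ => x) h]
  simp [metricSpeed]

theorem metricSpeed_le_of_eventually {φ : ℝ → X} {s : ℝ} {C : ℝ} (hC : 0 ≤ C)
    (h : ∀ m > C, ∀ᶠ r in 𝓝 s, dist (φ r) (φ s) ≤ m * |r - s|) :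
    metricSpeed φ s ≤ ENNReal.ofReal C := by
  refine ENNReal.le_of_forall_pos_le_add fun ε hε _ => ?_
  rw [← ENNReal.ofReal_coe_nnreal, ← ENNReal.ofReal_add hC ε.coe_nonneg]
  refine limsup_le_of_le (h := ?_)
  filter_upwards [(h (C + ε) (by simpa using hε)).filter_mono nhdsWithin_le_nhds] with r hr
  refine ENNReal.div_le_of_le_mul ?_
  rw [edist_dist, edist_dist, ← ENNReal.ofReal_mul (by positivity), Real.dist_eq]
  exact ENNReal.ofReal_le_ofReal hr

/-- An absolutely continuous curve on `[a, b]`, extended by constants. -/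
theorem exists_constant_extension {φ : ℝ → X} {a b : ℝ} (hab : a < b)
    (hφ : AbsolutelyContinuousOnInterval φ a b) :
    ∃ f : ℝ → X, EqOn f φ (Icc a b) ∧ (∀ s, f s ∈ φ '' Icc a b) ∧ Continuous f ∧
      (∀ s r, AbsolutelyContinuousOnInterval f s r) ∧ ∀ s ∉ Icc a b, metricSpeed f s = 0 := by
  let p : ℝ → ℝ := fun s => max a (min s b)
  have hpmem : ∀ s, p s ∈ Icc a b := fun s => ⟨le_max_left _ _, max_le hab.le (min_le_right _ _)⟩
  have hpid : ∀ s ∈ Icc a b, p s = s := fun s hs => by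
    simp only [p, min_eq_left hs.2, max_eq_right hs.1]
  have hpmono : Monotone p := fun s r h => max_le_max_left _ (min_le_min_right _ h)
  have hpLip : LipschitzWith 1 p := (LipschitzWith.id.min_const b).const_max a
  let f : ℝ → X := fun s => φ (p s)
  have hfφ : EqOn f φ (Icc a b) := fun s hs => congrArg φ (hpid s hs)
  have hfac : ∀ s r, AbsolutelyContinuousOnInterval f s r := fun s r =>
    hφ.comp_monotone hpmono hpLip fun u _ => by rw [uIcc_of_le hab.le]; exact hpmem u
  have hfcont : Continuous f := by
    have hc : ContinuousOn φ (Icc a b) :=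
      uIcc_of_le hab.le ▸ continuousOn_of_absolutelyContinuousOnInterval hφ
    exact ContinuousOn.comp_continuous hc hpLip.continuous hpmem
  have hw0 : ∀ s, s ∉ Icc a b → metricSpeed f s = 0 := by
    intro s hs
    rw [mem_Icc, not_and_or, not_le, not_le] at hs
    rcases hs with hs | hs
    · refine metricSpeed_eq_zero_of_const (x := φ a) ?_
      filter_upwards [Iio_mem_nhds hs] with r hr
      simp only [f, p, min_eq_left ((mem_Iio.1 hr).le.trans hab.le),
        max_eq_left (mem_Iio.1 hr).le]
    · refine metricSpeed_eq_zero_of_const (x := φ b) ?_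
      filter_upwards [Ioi_mem_nhds hs] with r hr
      simp only [f, p, min_eq_right (mem_Ioi.1 hr).le, max_eq_right hab.le]
  exact ⟨f, hfφ, fun s => ⟨_, hpmem s, rfl⟩, hfcont, hfac, hw0⟩

/-- Time change with density `κ + |φ̇| / ρ(φ)`: the reparametrized curve `ψ` has speed at most
`ρ(ψ)`. The positive constant `κ` keeps the new time strictly increasing where the curve rests, so
that it is a homeomorphism also for constant curves. -/
theorem exists_reparametrization {φ : ℝ → X} {a b : ℝ} (hab : a < b)
    (hφ : AbsolutelyContinuousOnInterval φ a b) (hlen : metricLength φ a b ≠ ∞)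
    {ρ : X → ℝ} (hρ : Continuous ρ) (hpos : ∀ x, 0 < ρ x) {κ : ℝ} (hκ : 0 < κ) :
    ∃ (ℓ : ℝ) (ψ : ℝ → X), 0 < ℓ ∧ ψ 0 = φ a ∧ ψ ℓ = φ b ∧ (∀ u, ψ u ∈ φ '' Icc a b) ∧
      (∃ K, LipschitzWith K ψ) ∧
      (∀ u, ∀ m > ρ (ψ u), ∀ᶠ z in 𝓝 u, dist (ψ z) (ψ u) ≤ m * |z - u|) ∧
      ∫⁻ u in Ioc 0 ℓ, ENNReal.ofReal (ρ (ψ u)) ^ 2 =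
        (∫⁻ s in Ioc a b, ENNReal.ofReal (ρ (φ s)) * metricSpeed φ s) +
          ENNReal.ofReal κ * ∫⁻ s in Ioc a b, ENNReal.ofReal (ρ (φ s)) ^ 2 := by
  obtain ⟨f, hfφ, hfim, hfcont, hfac, hw0⟩ := exists_constant_extension hab hφ
  have hwm : Measurable (metricSpeed f) := measurable_metricSpeed hfcont
  have hwfin : ∫⁻ s, metricSpeed f s ≠ ∞ := by
    have h1 : ∫⁻ s in Icc a b, metricSpeed f s = ∫⁻ s, metricSpeed f s :=
      setLIntegral_eq_of_support_subset fun s hs => by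
        by_contra h; exact hs (hw0 s h)
    rw [← h1, ← restrict_Ioc_eq_restrict_Icc]
    rwa [← metricLength_congr hfφ] at hlen
  -- A positive lower bound and an upper bound for `ρ` along the curve.
  have hcomp : IsCompact (φ '' Icc a b) :=
    isCompact_Icc.image_of_continuousOn
      (by simpa [uIcc_of_le hab.le] using continuousOn_of_absolutelyContinuousOnInterval hφ)
  obtain ⟨y₀, hy₀, hmin⟩ := hcomp.exists_isMinOn ⟨_, hfim a⟩ hρ.continuousOn
  obtain ⟨y₁, hy₁, hmax⟩ := hcomp.exists_isMaxOn ⟨_, hfim a⟩ hρ.continuousOn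
  -- The new time `W` is the primitive of `k`.
  set k : ℝ → ℝ≥0∞ := fun s => metricSpeed f s / ENNReal.ofReal (ρ (f s)) + ENNReal.ofReal κ
    with hk
  have hkm : Measurable k :=
    (hwm.div (hρ.comp hfcont).measurable.ennreal_ofReal).add_const _
  have hkfin : ∀ s r, ∫⁻ u in Ioc s r, k u ≠ ∞ := by
    intro s r
    have : ∫⁻ u in Ioc s r, k u ≤
        ∫⁻ u in Ioc s r, (metricSpeed f u * (ENNReal.ofReal (ρ y₀))⁻¹ + ENNReal.ofReal κ) := by
      refine lintegral_mono fun u => ?_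
      simp only [hk, div_eq_mul_inv]
      gcongr
      exact hmin (hfim u)
    refine ne_top_of_le_ne_top ?_ this
    rw [lintegral_add_right _ measurable_const, lintegral_mul_const _ hwm]
    refine ENNReal.add_ne_top.2 ⟨ENNReal.mul_ne_top ?_ ?_, ?_⟩
    · exact ne_top_of_le_ne_top hwfin (setLIntegral_le_lintegral _ _)
    · simpa using hpos y₀
    · simp [ENNReal.mul_ne_top]
  have hkint : ∀ s r, IntervalIntegrable (fun u => (k u).toReal) volume s r := fun s r =>
    ⟨integrable_toReal_of_lintegral_ne_top hkm.aemeasurable (hkfin s r),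
      integrable_toReal_of_lintegral_ne_top hkm.aemeasurable (hkfin r s)⟩
  set W : ℝ → ℝ := fun s => ∫ u in a..s, (k u).toReal
  have hWsub : ∀ s r, s ≤ r → ENNReal.ofReal (W r - W s) = ∫⁻ u in Ioc s r, k u := by
    intro s r hsr
    simp only [W]
    rw [intervalIntegral.integral_interval_sub_left (hkint _ _) (hkint _ _),
      intervalIntegral.integral_of_le hsr,
      integral_toReal hkm.aemeasurable (ae_lt_top hkm (hkfin s r)),
      ENNReal.ofReal_toReal (hkfin s r)]
  have hWκ : ∀ s r, s ≤ r → κ * (r - s) ≤ W r - W s := by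
    intro s r hsr
    have h1 : ENNReal.ofReal (κ * (r - s)) ≤ ENNReal.ofReal (W r - W s) := by
      rw [hWsub s r hsr, ENNReal.ofReal_mul hκ.le]
      calc ENNReal.ofReal κ * ENNReal.ofReal (r - s) = ∫⁻ _ in Ioc s r, ENNReal.ofReal κ := by
            simp
        _ ≤ _ := lintegral_mono fun u => le_add_self
    rcases hsr.eq_or_lt with rfl | h
    · simp
    · have h2 : 0 < κ * (r - s) := mul_pos hκ (sub_pos.2 h)
      refine (ENNReal.ofReal_le_ofReal_iff ?_).1 h1
      by_contra h3
      rw [ENNReal.ofReal_of_nonpos (not_le.1 h3).le] at h1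
      exact h2.not_ge (by simpa using h1)
  have hWmono : StrictMono W := fun s r hsr => by
    have := hWκ s r hsr.le
    have := mul_pos hκ (sub_pos.2 hsr)
    linarith
  have hWcont : Continuous W := intervalIntegral.continuous_primitive (fun s r => hkint s r) a
  have hWa : W a = 0 := by simp [W]
  have hWsurj : Function.Surjective W := by
    refine hWcont.surjective ?_ ?_
    · refine tendsto_atTop_mono' atTop (f₁ := fun s => κ * (s - a)) ?_ ?_
      · filter_upwards [eventually_ge_atTop a] with s hs
        have := hWκ a s hs; linarith
      · exact (tendsto_atTop_add_const_right _ (-a) tendsto_id).const_mul_atTop hκ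
    · have h : W ≤ᶠ[atBot] fun s => κ * (s - a) := by
        filter_upwards [eventually_le_atBot a] with s hs
        have := hWκ s a hs; linarith
      exact tendsto_atBot_mono' atBot h
        ((tendsto_atBot_add_const_right _ (-a) tendsto_id).const_mul_atBot hκ)
  set e : ℝ ≃o ℝ := hWmono.orderIsoOfSurjective W hWsurj
  have hsymm : ∀ u, W (e.symm u) = u := fun u => e.apply_symm_apply u
  have hesymm : ∀ s, e.symm (W s) = s := fun s => e.symm_apply_apply s
  set ψ : ℝ → X := fun u => f (e.symm u) with hψ
  -- Where `ρ ≤ m`, the reparametrized curve is `m`-Lipschitz.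
  have hdist : ∀ m u z, u ≤ z → (∀ v ∈ Icc u z, ρ (ψ v) ≤ m) →
      dist (ψ u) (ψ z) ≤ m * (z - u) := by
    intro m u z huz hm
    have hm0 : 0 < m := (hpos _).trans_le (hm u ⟨le_rfl, huz⟩)
    have hle : e.symm u ≤ e.symm z := e.symm.monotone huz
    have h1 : edist (ψ u) (ψ z) ≤ ENNReal.ofReal (m * (z - u)) := by
      calc edist (ψ u) (ψ z) ≤ ∫⁻ s in Ioc (e.symm u) (e.symm z), metricSpeed f s :=
            edist_le_metricLength hle (hfac _ _)
        _ ≤ ∫⁻ s in Ioc (e.symm u) (e.symm z), ENNReal.ofReal m * k s := by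
            refine setLIntegral_mono (hkm.const_mul _) fun s hs => ?_
            have hs' : W s ∈ Icc u z := by
              rw [← hsymm u, ← hsymm z]
              exact ⟨hWmono.monotone hs.1.le, hWmono.monotone hs.2⟩
            have hρs : ρ (f s) ≤ m := by
              have := hm _ hs'
              rwa [hψ, show (fun u => f (e.symm u)) (W s) = f s by simp only [hesymm]] at this
            calc metricSpeed f s = ENNReal.ofReal (ρ (f s)) *
                  (metricSpeed f s / ENNReal.ofReal (ρ (f s))) :=
                  (ENNReal.mul_div_cancel (by simpa using hpos _) (by simp)).symm
              _ ≤ ENNReal.ofReal m * k s := by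
                  gcongr
                  exact le_self_add
        _ = ENNReal.ofReal (m * (z - u)) := by
            rw [lintegral_const_mul _ hkm, ← hWsub _ _ hle, hsymm, hsymm,
              ENNReal.ofReal_mul hm0.le]
    rw [edist_dist] at h1
    exact (ENNReal.ofReal_le_ofReal_iff (mul_nonneg hm0.le (sub_nonneg.2 huz))).1 h1
  have hψLip : LipschitzWith (ρ y₁).toNNReal ψ := by
    refine LipschitzWith.of_dist_le_mul fun u z => ?_
    rw [Real.coe_toNNReal _ (hpos _).le]
    rcases le_total u z with h | h
    · rw [dist_comm u, Real.dist_eq, abs_of_nonneg (sub_nonneg.2 h)]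
      exact hdist _ _ _ h fun v _ => hmax (hfim _)
    · rw [dist_comm, Real.dist_eq, abs_of_nonneg (sub_nonneg.2 h)]
      exact hdist _ _ _ h fun v _ => hmax (hfim _)
  -- The new time turns `k ds` into Lebesgue measure.
  have hmap : (volume.withDensity k).map W = volume := by
    refine Measure.ext_of_Ioc' _ _ ?_ ?_
    all_goals
      intro c d hcd
      have hpre : W ⁻¹' Ioc c d = Ioc (e.symm c) (e.symm d) := e.preimage_Ioc c d
      rw [Measure.map_apply hWcont.measurable measurableSet_Ioc, hpre,
        withDensity_apply _ measurableSet_Ioc]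
    · exact hkfin _ _
    · rw [← hWsub _ _ (e.symm.monotone hcd.le), hsymm, hsymm, Real.volume_Ioc]
  have hpre : W ⁻¹' Ioc 0 (W b) = Ioc a b := by
    have := e.preimage_Ioc (W a) (W b)
    rw [hesymm, hesymm, hWa] at this
    exact this
  refine ⟨W b, ψ, ?_, ?_, ?_, fun u => hfim _, ⟨_, hψLip⟩, ?_, ?_⟩
  · rw [← hWa]; exact hWmono hab
  · have : e.symm 0 = a := by rw [← hWa, hesymm]
    simp only [hψ, this]; exact hfφ ⟨le_rfl, hab.le⟩
  · simp only [hψ, hesymm]; exact hfφ ⟨hab.le, le_rfl⟩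
  · intro u m hm
    have hev : ∀ᶠ z in 𝓝 u, ρ (ψ z) < m :=
      (hρ.comp hψLip.continuous).continuousAt.eventually_lt_const hm
    obtain ⟨ε, hε, hball⟩ := Metric.eventually_nhds_iff_ball.1 hev
    filter_upwards [Metric.ball_mem_nhds u hε] with z hz
    have hsub : ∀ v ∈ uIcc u z, ρ (ψ v) ≤ m := fun v hv => by
      refine (hball v ?_).le
      exact lt_of_le_of_lt (by simpa [Real.dist_eq] using abs_sub_left_of_mem_uIcc hv) hz
    rcases le_total u z with h | h
    · rw [uIcc_of_le h] at hsub
      rw [dist_comm, abs_of_nonneg (sub_nonneg.2 h)]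
      exact hdist _ _ _ h hsub
    · rw [uIcc_of_ge h] at hsub
      rw [abs_sub_comm, abs_of_nonneg (sub_nonneg.2 h)]
      exact hdist _ _ _ h hsub
  · have hF : Measurable fun u => ENNReal.ofReal (ρ (ψ u)) ^ 2 :=
      ((hρ.comp hψLip.continuous).measurable.ennreal_ofReal).pow_const 2
    conv_lhs => rw [← hmap]
    rw [setLIntegral_map measurableSet_Ioc hF hWcont.measurable, hpre,
      setLIntegral_withDensity_eq_setLIntegral_mul _ hkm
        (g := fun s => ENNReal.ofReal (ρ (ψ (W s))) ^ 2) (hF.comp hWcont.measurable)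
        measurableSet_Ioc,
      ← lintegral_const_mul' _ _ ENNReal.ofReal_ne_top]
    have hfρ : Measurable fun s => ENNReal.ofReal (ρ (f s)) :=
      (hρ.comp hfcont).measurable.ennreal_ofReal
    have hcongr : ∀ᵐ s ∂(volume.restrict (Ioc a b)), f s = φ s ∧
        metricSpeed f s = metricSpeed φ s :=
      ae_restrict_Ioc_of_Ioo fun s hs =>
        ⟨hfφ ⟨hs.1.le, hs.2.le⟩, metricSpeed_congr_of_mem_Ioo hfφ hs⟩
    have h1 : ∫⁻ s in Ioc a b, ENNReal.ofReal (ρ (φ s)) * metricSpeed φ s =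
        ∫⁻ s in Ioc a b, ENNReal.ofReal (ρ (f s)) * metricSpeed f s :=
      lintegral_congr_ae (hcongr.mono fun s hs => by simp only [hs.1, hs.2])
    have h2 : ∫⁻ s in Ioc a b, ENNReal.ofReal κ * ENNReal.ofReal (ρ (φ s)) ^ 2 =
        ∫⁻ s in Ioc a b, ENNReal.ofReal κ * ENNReal.ofReal (ρ (f s)) ^ 2 :=
      lintegral_congr_ae (hcongr.mono fun s hs => by simp only [hs.1])
    rw [h1, h2, ← lintegral_add_left (f := fun s => ENNReal.ofReal (ρ (f s)) * metricSpeed f s)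
      (hfρ.mul hwm)]
    refine lintegral_congr fun s => ?_
    have h0 : ENNReal.ofReal (ρ (f s)) ≠ 0 := by simpa using hpos _
    simp only [Pi.mul_apply, hψ, hesymm, hk]
    rw [add_mul]
    congr 1
    rw [sq, ← mul_assoc, ENNReal.div_mul_cancel h0 ENNReal.ofReal_ne_top, mul_comm]

theorem aemeasurable_metricSpeed {φ : ℝ → X} {a b : ℝ} (hab : a < b)
    (hφ : AbsolutelyContinuousOnInterval φ a b) :
    AEMeasurable (metricSpeed φ) (volume.restrict (Ioc a b)) := by
  obtain ⟨f, hfφ, -, hfcont, -, -⟩ := exists_constant_extension hab hφ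
  exact (measurable_metricSpeed hfcont).aemeasurable.congr
    (ae_restrict_Ioc_of_Ioo fun s hs => metricSpeed_congr_of_mem_Ioo hfφ hs)

/-- A curve of finite length can be reparametrized, almost without loss, so that its speed is close
to a given function `g` of the position. Since `½ (g² + v²)` and `g v` agree for speed `v = g`, the
action of the new curve is nearly `∫ g |φ̇|`. -/
theorem exists_almost_optimal_reparametrization {φ : ℝ → X} {a b : ℝ} (hab : a < b)
    (hφ : AbsolutelyContinuousOnInterval φ a b) (hlen : metricLength φ a b ≠ ∞)
    {g : X → ℝ} (hg : Continuous g) (hg0 : ∀ x, 0 ≤ g x) {ε : ℝ} (hε : 0 < ε) :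
    ∃ (δ ℓ : ℝ) (ψ : ℝ → X), 0 < δ ∧ δ ≤ 1 ∧ 0 < ℓ ∧ ψ 0 = φ a ∧ ψ ℓ = φ b ∧
      (∀ u, ψ u ∈ φ '' Icc a b) ∧ (∃ K, LipschitzWith K ψ) ∧
      (∀ u, ∀ m > g (ψ u) + δ, ∀ᶠ z in 𝓝 u, dist (ψ z) (ψ u) ≤ m * |z - u|) ∧
      ∫⁻ u in Ioc 0 ℓ, ENNReal.ofReal (g (ψ u) + δ) ^ 2 ≤
        (∫⁻ s in Ioc a b, ENNReal.ofReal (g (φ s)) * metricSpeed φ s) + ENNReal.ofReal ε := by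
  have hcomp : IsCompact (φ '' Icc a b) :=
    isCompact_Icc.image_of_continuousOn
      (by simpa [uIcc_of_le hab.le] using continuousOn_of_absolutelyContinuousOnInterval hφ)
  obtain ⟨M, hM⟩ := hcomp.bddAbove_image hg.continuousOn
  have hM' : ∀ s ∈ Ioc a b, g (φ s) ≤ M := fun s hs =>
    hM ⟨_, ⟨s, ⟨hs.1.le, hs.2⟩, rfl⟩, rfl⟩
  -- `δ` is small relative to the length, `κ = ε / (2 N)` relative to the bound `N` of `∫ ρ(φ)²`.
  set Λ := (metricLength φ a b).toReal with hΛ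
  have hΛ0 : 0 ≤ Λ := ENNReal.toReal_nonneg
  set δ := min 1 (ε / 2 / (Λ + 1)) with hδ
  have hδ0 : 0 < δ := lt_min one_pos (by positivity)
  have hδΛ : δ * Λ ≤ ε / 2 := by
    calc δ * Λ ≤ ε / 2 / (Λ + 1) * (Λ + 1) := by gcongr; exact min_le_right _ _; linarith
      _ = ε / 2 := by field_simp
  have hba : 0 < b - a := sub_pos.2 hab
  set N := (|M| + 1) ^ 2 * (b - a) with hN
  have hN0 : 0 < N := by positivity
  have hκ : 0 < ε / 2 / N := by positivity
  obtain ⟨ℓ, ψ, hℓ, h0, h1, him, hLip, hsp, hint⟩ := exists_reparametrization hab hφ hlen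
    (ρ := fun x => g x + δ) (hg.add continuous_const) (fun x => by linarith [hg0 x]) hκ
  refine ⟨δ, ℓ, ψ, hδ0, min_le_left _ _, hℓ, h0, h1, him, hLip, hsp, hint.trans_le ?_⟩
  have e1 : ∫⁻ s in Ioc a b, ENNReal.ofReal (g (φ s) + δ) * metricSpeed φ s =
      (∫⁻ s in Ioc a b, ENNReal.ofReal (g (φ s)) * metricSpeed φ s) +
        ENNReal.ofReal δ * metricLength φ a b := by
    rw [metricLength, ← lintegral_const_mul' _ _ ENNReal.ofReal_ne_top,
      ← lintegral_add_right' _ ((aemeasurable_metricSpeed hab hφ).const_mul _)]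
    refine lintegral_congr fun s => ?_
    rw [ENNReal.ofReal_add (hg0 _) hδ0.le, add_mul]
  have e2 : ENNReal.ofReal δ * metricLength φ a b ≤ ENNReal.ofReal (ε / 2) := by
    rw [← ENNReal.ofReal_toReal hlen, ← ENNReal.ofReal_mul hδ0.le]
    exact ENNReal.ofReal_le_ofReal hδΛ
  have e3 : ∫⁻ s in Ioc a b, ENNReal.ofReal (g (φ s) + δ) ^ 2 ≤ ENNReal.ofReal N := by
    calc ∫⁻ s in Ioc a b, ENNReal.ofReal (g (φ s) + δ) ^ 2
        ≤ ∫⁻ s in Ioc a b, ENNReal.ofReal (|M| + 1) ^ 2 := by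
          refine setLIntegral_mono measurable_const fun s hs => ?_
          gcongr
          · exact (hM' s hs).trans (le_abs_self M)
          · exact min_le_left _ _
      _ = ENNReal.ofReal N := by
          rw [lintegral_const, Measure.restrict_apply_univ, Real.volume_Ioc, hN,
            ENNReal.ofReal_mul (by positivity), ENNReal.ofReal_pow (by positivity)]
  calc _ ≤ (∫⁻ s in Ioc a b, ENNReal.ofReal (g (φ s)) * metricSpeed φ s) +
        ENNReal.ofReal (ε / 2) + ENNReal.ofReal (ε / 2 / N) * ENNReal.ofReal N := by
        rw [e1]; gcongr
    _ = _ := by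
        rw [← ENNReal.ofReal_mul hκ.le, div_mul_cancel₀ _ hN0.ne', add_assoc,
          ← ENNReal.ofReal_add (by positivity) (by positivity), add_halves]

/-! ### The slope -/

theorem descSlope_le_of_eventually {f : X → ℝ} {x : X} {C : ℝ}
    (h : ∀ᶠ y in 𝓝 x, f x - f y ≤ C * dist x y) : descSlope f x ≤ ENNReal.ofReal C := by
  refine limsup_le_of_le (h := ?_)
  filter_upwards [h.filter_mono nhdsWithin_le_nhds] with y hy
  refine ENNReal.div_le_of_le_mul ?_
  rw [edist_dist, ← ENNReal.ofReal_mul' dist_nonneg]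
  exact ENNReal.ofReal_le_ofReal hy

theorem eventually_sub_le_of_descSlope_lt {f : X → ℝ} {x : X} {C : ℝ} (hC : 0 ≤ C)
    (h : descSlope f x < ENNReal.ofReal C) : ∀ᶠ y in 𝓝 x, f x - f y ≤ C * dist x y := by
  have h' := eventually_nhdsWithin_iff.1 (eventually_lt_of_limsup_lt h)
  filter_upwards [h'] with y hy
  rcases eq_or_ne y x with rfl | hyx
  · simp
  have h2 := (hy hyx).le
  rw [ENNReal.div_le_iff (by simpa [edist_eq_zero] using hyx.symm) (edist_ne_top _ _), edist_dist,
    ← ENNReal.ofReal_mul hC] at h2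
  exact (ENNReal.ofReal_le_ofReal_iff (by positivity)).1 h2

/-- The slope is a strong upper gradient: it suffices that a continuous function bounds the slope of
`f` pointwise. -/
theorem ofReal_sub_le_lintegral {f g : X → ℝ} (hf : Continuous f) (hg : Continuous g)
    (hg0 : ∀ x, 0 ≤ g x) (hfg : ∀ x, descSlope f x ≤ ENNReal.ofReal (g x))
    {φ : ℝ → X} {a b : ℝ} (hab : a < b) (hφ : AbsolutelyContinuousOnInterval φ a b)
    (hlen : metricLength φ a b ≠ ∞) :
    ENNReal.ofReal (f (φ a) - f (φ b)) ≤
      ∫⁻ s in Ioc a b, ENNReal.ofReal (g (φ s)) * metricSpeed φ s := by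
  refine ENNReal.le_of_forall_pos_le_add fun ε hε _ => ?_
  obtain ⟨δ, ℓ, ψ, hδ, -, hℓ, h0, h1, -, ⟨K, hK⟩, hsp, hint⟩ :=
    exists_almost_optimal_reparametrization hab hφ hlen hg hg0 (ε := ε) (by simpa using hε)
  rw [ENNReal.ofReal_coe_nnreal] at hint
  refine le_trans ?_ hint
  have hρ : Continuous fun u => g (ψ u) + δ := (hg.comp hK.continuous).add continuous_const
  have hρ0 : ∀ u, 0 < g (ψ u) + δ := fun u => by linarith [hg0 (ψ u)]
  have hρ2 : Continuous fun u => (g (ψ u) + δ) ^ 2 := hρ.pow 2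
  have key : f (ψ 0) - f (ψ ℓ) ≤ ∫ u in (0 : ℝ)..ℓ, (g (ψ u) + δ) ^ 2 := by
    refine image_le_of_liminf_slope_right_le_deriv_boundary
      (f := fun u => f (ψ 0) - f (ψ u)) (B := fun u => ∫ v in (0 : ℝ)..u, (g (ψ v) + δ) ^ 2)
      (B' := fun u => (g (ψ u) + δ) ^ 2) (a := 0) (b := ℓ)
      (continuous_const.sub (hf.comp hK.continuous)).continuousOn (by simp)
      (intervalIntegral.continuous_primitive (fun _ _ => hρ2.intervalIntegrable _ _) 0).continuousOn
      (fun u _ => (intervalIntegral.integral_hasDerivAt_right (hρ2.intervalIntegrable _ _)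
        (hρ2.stronglyMeasurableAtFilter _ _) hρ2.continuousAt).hasDerivWithinAt)
      ?_ ⟨hℓ.le, le_rfl⟩
    intro u _ r hr
    refine Eventually.frequently ?_
    -- A speed bound `m` slightly above `ρ = g + δ`, with `ρ m < r`.
    obtain ⟨m, hm1, hm2⟩ : ∃ m, g (ψ u) + δ < m ∧ (g (ψ u) + δ) * m < r := by
      have : g (ψ u) + δ < r / (g (ψ u) + δ) := by
        rw [lt_div_iff₀ (hρ0 u), ← sq]; exact hr
      obtain ⟨m, hm1, hm2⟩ := exists_between this
      exact ⟨m, hm1, by rwa [lt_div_iff₀' (hρ0 u)] at hm2⟩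
    have hsl : descSlope f (ψ u) < ENNReal.ofReal (g (ψ u) + δ) :=
      (hfg _).trans_lt ((ENNReal.ofReal_lt_ofReal_iff (hρ0 u)).2 (by linarith))
    have ev1 := hK.continuous.continuousAt.eventually
      (eventually_sub_le_of_descSlope_lt (hρ0 u).le hsl)
    filter_upwards [ev1.filter_mono nhdsWithin_le_nhds,
      (hsp u m hm1).filter_mono nhdsWithin_le_nhds, self_mem_nhdsWithin] with z hz1 hz2 hz
    have hz' : 0 < z - u := sub_pos.2 hz
    rw [abs_of_pos hz'] at hz2
    rw [slope_def_field, div_lt_iff₀ hz']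
    calc f (ψ 0) - f (ψ z) - (f (ψ 0) - f (ψ u)) = f (ψ u) - f (ψ z) := by ring
      _ ≤ (g (ψ u) + δ) * dist (ψ u) (ψ z) := hz1
      _ ≤ (g (ψ u) + δ) * (m * (z - u)) := by
          rw [dist_comm]; exact mul_le_mul_of_nonneg_left hz2 (hρ0 u).le
      _ = (g (ψ u) + δ) * m * (z - u) := by ring
      _ < r * (z - u) := by gcongr
  rw [← h0, ← h1]
  refine (ENNReal.ofReal_le_ofReal key).trans ?_
  rw [intervalIntegral.integral_of_le hℓ.le, ofReal_integral_eq_lintegral_ofReal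
    (hρ2.integrableOn_Ioc) (Eventually.of_forall fun u => by positivity)]
  exact (lintegral_congr fun u => ENNReal.ofReal_pow (hρ0 u).le 2).le

/-! ### Dissipation along a curve -/

theorem mul_le_half_sq_add_sq (x y : ℝ≥0∞) : x * y ≤ 2⁻¹ * (x ^ 2 + y ^ 2) := by
  rcases eq_or_ne x ∞ with rfl | hx
  · simp [ENNReal.mul_top]
  rcases eq_or_ne y ∞ with rfl | hy
  · simp [ENNReal.mul_top]
  lift x to ℝ≥0 using hx
  lift y to ℝ≥0 using hy
  have h : x * y ≤ 2⁻¹ * (x ^ 2 + y ^ 2) := by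
    rw [← NNReal.coe_le_coe]; push_cast
    nlinarith [sq_nonneg ((x : ℝ) - y)]
  have h2 : ((2⁻¹ : ℝ≥0) : ℝ≥0∞) = 2⁻¹ := by simp
  rw [← h2]
  exact_mod_cast h

theorem half_sq_add_sq_le {x y z : ℝ≥0∞} (hx : x ≤ z) (hy : y ≤ z) :
    2⁻¹ * (x ^ 2 + y ^ 2) ≤ z ^ 2 := by
  calc 2⁻¹ * (x ^ 2 + y ^ 2) ≤ 2⁻¹ * (z ^ 2 + z ^ 2) := by gcongr
    _ = z ^ 2 := by
      rw [← two_mul, ← mul_assoc, ENNReal.inv_mul_cancel two_ne_zero ENNReal.ofNat_ne_top, one_mul]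

theorem lintegral_mul_le_gfDissipation (E : ℝ → X → ℝ) (t : ℝ) (φ : ℝ → X) (a b : ℝ) :
    ∫⁻ s in Ioc a b, descSlope (E t) (φ s) * metricSpeed φ s ≤ gfDissipation E t φ a b := by
  rw [gfDissipation, ← lintegral_const_mul' _ _ (by simp)]
  exact lintegral_mono fun s => mul_le_half_sq_add_sq _ _

theorem metricLength_ne_top_of_gfDissipation {E : ℝ → X → ℝ} {t : ℝ} {φ : ℝ → X} {a b : ℝ}
    (h : gfDissipation E t φ a b ≠ ∞) : metricLength φ a b ≠ ∞ := by
  have h1 : ∫⁻ s in Ioc a b, (descSlope (E t) (φ s) ^ 2 + metricSpeed φ s ^ 2) ≠ ∞ := by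
    intro h'
    exact h (by rw [gfDissipation, h']; simp [ENNReal.mul_top])
  refine ne_top_of_le_ne_top (b := ∫⁻ s in Ioc a b,
    (1 + (descSlope (E t) (φ s) ^ 2 + metricSpeed φ s ^ 2))) ?_ (lintegral_mono fun s => ?_)
  · rw [lintegral_add_left measurable_const]
    exact ENNReal.add_ne_top.2 ⟨by simp, h1⟩
  · rcases le_total (metricSpeed φ s) 1 with h | h
    · exact h.trans le_self_add
    · calc metricSpeed φ s ≤ metricSpeed φ s ^ 2 := le_self_pow₀ h two_ne_zero
        _ ≤ _ := le_add_self.trans le_add_self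

theorem gfDissipation_mono {E : ℝ → X → ℝ} {t : ℝ} {φ : ℝ → X} {a b c d : ℝ} (hac : a ≤ c)
    (hdb : d ≤ b) : gfDissipation E t φ c d ≤ gfDissipation E t φ a b := by
  unfold gfDissipation
  gcongr

theorem gfAction_le {E : ℝ → X → ℝ} {t a b : ℝ} {φ : ℝ → X} (hab : a < b)
    (hφ : AbsolutelyContinuousOnInterval φ a b) :
    gfAction E t (φ a) (φ b) ≤ gfDissipation E t φ a b :=
  iInf_le_of_le a <| iInf_le_of_le b <| iInf_le_of_le φ <| iInf_le _ ⟨hab, hφ, rfl, rfl⟩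

theorem continuous_toReal_descSlope {f : X → ℝ} (hfin : ∀ x, descSlope f x ≠ ∞)
    (hcont : Continuous (descSlope f)) : Continuous fun x => (descSlope f x).toReal :=
  ENNReal.continuousOn_toReal.comp_continuous hcont hfin

/-- Every function whose slope is at most that of `E_t` drops by at most the action. -/
theorem ofReal_sub_le_gfAction {E : ℝ → X → ℝ} {t : ℝ} (hfin : ∀ x, descSlope (E t) x ≠ ∞)
    (hcont : Continuous (descSlope (E t))) {f : X → ℝ} (hf : Continuous f)
    (hfE : ∀ x, descSlope f x ≤ descSlope (E t) x) (x y : X) :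
    ENNReal.ofReal (f x - f y) ≤ gfAction E t x y := by
  refine le_iInf fun a => le_iInf fun b => le_iInf fun φ => le_iInf fun ⟨hab, hφ, ha, hb⟩ => ?_
  rcases eq_or_ne (gfDissipation E t φ a b) ∞ with h | h
  · rw [h]; exact le_top
  rw [← ha, ← hb]
  refine le_trans ?_ (lintegral_mul_le_gfDissipation E t φ a b)
  have := ofReal_sub_le_lintegral hf (continuous_toReal_descSlope hfin hcont)
    (fun _ => ENNReal.toReal_nonneg)
    (fun x => by rw [ENNReal.ofReal_toReal (hfin x)]; exact hfE x) hab hφ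
    (metricLength_ne_top_of_gfDissipation h)
  simpa only [ENNReal.ofReal_toReal (hfin _)] using this

/-! ### Admissible curves in phase space -/

theorem coe_gfPrice {E : ℝ → X → ℝ} {t : ℝ} {p : GFPhase X} (hfin : descSlope (E t) p.fst ≠ ∞) :
    (gfPrice E t p : ℝ≥0∞) = 2⁻¹ * (descSlope (E t) p.fst ^ 2 + (p.snd : ℝ≥0∞) ^ 2) := by
  have h2 : ((2⁻¹ : ℝ≥0) : ℝ≥0∞) = 2⁻¹ := by simp
  rw [gfPrice, ENNReal.coe_add, ENNReal.coe_mul, ENNReal.coe_mul, ENNReal.coe_pow, ENNReal.coe_pow,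
    ENNReal.coe_toNNReal hfin, h2, mul_add]

theorem lintegral_gfPrice {E : ℝ → X → ℝ} {t : ℝ} (hfin : ∀ x, descSlope (E t) x ≠ ∞)
    {γ : ℝ → GFPhase X} {a b : ℝ}
    (hγ : ∀ᵐ s ∂(volume.restrict (Ioc a b)),
      metricSpeed (fun r => (γ r).fst) s = ((γ s).snd : ℝ≥0∞)) :
    ∫⁻ s in Ioc a b, (gfPrice E t (γ s) : ℝ≥0∞) =
      gfDissipation E t (fun s => (γ s).fst) a b := by
  rw [gfDissipation, ← lintegral_const_mul' _ _ (by simp)]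
  refine lintegral_congr_ae ?_
  filter_upwards [hγ] with s hs
  rw [coe_gfPrice (hfin _), hs]

open Classical in
/-- The lift of a curve `φ` on `[a, b]` to phase space: the velocity is the metric speed inside the
interval and is prescribed at the endpoints. -/
noncomputable def phaseLift (φ : ℝ → X) (a b : ℝ) (v₁ v₂ : ℝ≥0) (s : ℝ) : GFPhase X :=
  WithLp.toLp 1 (φ s, if s = a then v₁ else if s = b then v₂ else (metricSpeed φ s).toNNReal)

theorem phaseLift_snd_of_mem_Ioo {φ : ℝ → X} {a b s : ℝ} {v₁ v₂ : ℝ≥0} (hs : s ∈ Ioo a b) :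
    (phaseLift φ a b v₁ v₂ s).snd = (metricSpeed φ s).toNNReal := by
  simp [phaseLift, hs.1.ne', hs.2.ne]

theorem phaseLift_mem_gfCurves {φ : ℝ → X} {a b : ℝ} (hab : a < b)
    (hφ : AbsolutelyContinuousOnInterval φ a b) (hlen : metricLength φ a b ≠ ∞)
    {p₁ p₂ : GFPhase X} (h₁ : φ a = p₁.fst) (h₂ : φ b = p₂.fst) :
    phaseLift φ a b p₁.snd p₂.snd ∈ gfCurves p₁ p₂ a b := by
  refine ⟨hab, ?_, ?_, hφ, ?_⟩
  · simp [phaseLift, h₁]; rfl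
  · simp [phaseLift, hab.ne', h₂]; rfl
  · have h1 : ∀ᵐ s ∂(volume.restrict (Ioc a b)), metricSpeed φ s < ∞ :=
      ae_lt_top' (aemeasurable_metricSpeed hab hφ) hlen
    have h2 : ∀ᵐ s ∂(volume.restrict (Ioc a b)),
        (phaseLift φ a b p₁.snd p₂.snd s).snd = (metricSpeed φ s).toNNReal :=
      ae_restrict_Ioc_of_Ioo fun s hs => phaseLift_snd_of_mem_Ioo hs
    filter_upwards [h1, h2] with s hs1 hs2
    rw [hs2, ENNReal.coe_toNNReal hs1.ne]
    rfl

/-- The velocities prescribed at the endpoints do not influence the action. -/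
theorem phaseAction_eq_gfAction {E : ℝ → X → ℝ} {t : ℝ} (hfin : ∀ x, descSlope (E t) x ≠ ∞)
    (p₁ p₂ : GFPhase X) :
    phaseAction volume (gfCurves (X := X)) (gfPrice E) t p₁ p₂ =
      gfAction E t p₁.fst p₂.fst := by
  apply le_antisymm
  · refine le_iInf fun a => le_iInf fun b => le_iInf fun φ => le_iInf fun ⟨hab, hφ, ha, hb⟩ => ?_
    rcases eq_or_ne (gfDissipation E t φ a b) ∞ with h | h
    · rw [h]; exact le_top
    have hmem := phaseLift_mem_gfCurves hab hφ (metricLength_ne_top_of_gfDissipation h) ha hb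
    refine iInf_le_of_le a <| iInf_le_of_le b <| iInf_le_of_le _ <| iInf_le_of_le hmem ?_
    rw [lintegral_gfPrice hfin hmem.2.2.2.2]
    rfl
  · refine le_iInf fun a => le_iInf fun b => le_iInf fun γ => le_iInf fun hγ => ?_
    rw [lintegral_gfPrice hfin hγ.2.2.2.2]
    have := gfAction_le (E := E) (t := t) hγ.1 hγ.2.2.2.1
    simpa only [hγ.2.1, hγ.2.2.1] using this

theorem gfCurves_congr {p₁ p₂ : GFPhase X} {a b : ℝ} {γ γ' : ℝ → GFPhase X}
    (h : EqOn γ γ' (Icc a b)) (hγ : γ ∈ gfCurves p₁ p₂ a b) : γ' ∈ gfCurves p₁ p₂ a b := by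
  obtain ⟨hab, ha, hb, hac, hsp⟩ := hγ
  have hfst : EqOn (fun s => (γ s).fst) (fun s => (γ' s).fst) (Icc a b) := fun s hs => by
    simp only [h hs]
  refine ⟨hab, ?_, ?_, hac.congr (by rwa [uIcc_of_le hab.le]), ?_⟩
  · rw [← h ⟨le_rfl, hab.le⟩, ha]
  · rw [← h ⟨hab.le, le_rfl⟩, hb]
  · have h2 : ∀ᵐ s ∂(volume.restrict (Ioc a b)), γ s = γ' s ∧
        metricSpeed (fun r => (γ r).fst) s = metricSpeed (fun r => (γ' r).fst) s :=
      ae_restrict_Ioc_of_Ioo fun s hs =>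
        ⟨h ⟨hs.1.le, hs.2.le⟩, metricSpeed_congr_of_mem_Ioo hfst hs⟩
    filter_upwards [hsp, h2] with s hs1 hs2
    rw [← hs2.2, ← hs2.1, hs1]

theorem gfCurves_restriction {p₁ p₂ p₃ : GFPhase X} {a s b : ℝ} {γ : ℝ → GFPhase X}
    (hγ : γ ∈ gfCurves p₁ p₃ a b) (has : a < s) (hsb : s < b) (hs : γ s = p₂) :
    γ ∈ gfCurves p₁ p₂ a s ∧ γ ∈ gfCurves p₂ p₃ s b := by
  obtain ⟨hab, ha, hb, hac, hsp⟩ := hγ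
  refine ⟨⟨has, ha, hs, hac.mono ?_, ?_⟩, ⟨hsb, hs, hb, hac.mono ?_, ?_⟩⟩
  · rw [uIcc_of_le has.le, uIcc_of_le hab.le]; exact Icc_subset_Icc_right hsb.le
  · exact ae_restrict_of_ae_restrict_of_subset (Ioc_subset_Ioc_right hsb.le) hsp
  · rw [uIcc_of_le hsb.le, uIcc_of_le hab.le]; exact Icc_subset_Icc_left has.le
  · exact ae_restrict_of_ae_restrict_of_subset (Ioc_subset_Ioc_left has.le) hsp

theorem gfCurves_concatenation {p₁ p₂ p₃ : GFPhase X} {a s b : ℝ} {γ γ' : ℝ → GFPhase X}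
    (hγ : γ ∈ gfCurves p₁ p₂ a s) (hγ' : γ' ∈ gfCurves p₂ p₃ s b) :
    (fun r => if r ≤ s then γ r else γ' r) ∈ gfCurves p₁ p₃ a b := by
  have e1 : EqOn γ (fun r => if r ≤ s then γ r else γ' r) (Icc a s) := fun r hr => by
    simp [hr.2]
  have e2 : EqOn γ' (fun r => if r ≤ s then γ r else γ' r) (Icc s b) := fun r hr => by
    rcases hr.1.eq_or_lt with rfl | h
    · simp [hγ.2.2.1, hγ'.2.1]
    · simp [h.not_ge]
  obtain ⟨h1, ha, -, hac, hsp⟩ := gfCurves_congr e1 hγ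
  obtain ⟨h1', -, hb, hac', hsp'⟩ := gfCurves_congr e2 hγ'
  refine ⟨h1.trans h1', ha, hb, hac.trans h1.le h1'.le hac', ?_⟩
  rw [← Ioc_union_Ioc_eq_Ioc h1.le h1'.le, ae_restrict_union_iff]
  exact ⟨hsp, hsp'⟩

theorem gfCurves_shift {p₁ p₂ : GFPhase X} {a b : ℝ} (r : ℝ) {γ : ℝ → GFPhase X}
    (hγ : γ ∈ gfCurves p₁ p₂ a b) : (fun s => γ (s + r)) ∈ gfCurves p₁ p₂ (a - r) (b - r) := by
  obtain ⟨hab, ha, hb, hac, hsp⟩ := hγ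
  refine ⟨by linarith, by simpa using ha, by simpa using hb, ?_, ?_⟩
  · refine hac.comp_monotone (p := fun s => s + r) (fun x y h => add_le_add_left h r)
      (LipschitzWith.of_dist_le_mul fun x y => by simp) ?_
    intro s hs
    rw [uIcc_of_le (by linarith)] at hs
    rw [uIcc_of_le hab.le]
    exact ⟨by linarith [hs.1], by linarith [hs.2]⟩
  · have hmp := (measurePreserving_add_right volume r).restrict_preimage
      (measurableSet_Ioc (a := a) (b := b))
    rw [preimage_add_const_Ioc] at hmp
    filter_upwards [hmp.quasiMeasurePreserving.ae hsp] with s hs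
    rw [← hs]
    exact metricSpeed_comp_add_right (fun u => (γ u).fst) r s

theorem gfAction_triangle {E : ℝ → X → ℝ} {t : ℝ} (hfin : ∀ x, descSlope (E t) x ≠ ∞)
    (x y z : X) : gfAction E t x z ≤ gfAction E t x y + gfAction E t y z := by
  have hi : ∀ x : X, (gfEmbedding x).fst = x := fun _ => rfl
  rw [← hi x, ← hi y, ← hi z, ← phaseAction_eq_gfAction hfin, ← phaseAction_eq_gfAction hfin,
    ← phaseAction_eq_gfAction hfin]
  generalize gfEmbedding x = p₁, gfEmbedding y = p₂, gfEmbedding z = p₃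
  conv_rhs => rw [phaseAction, phaseAction]
  simp only [ENNReal.iInf_add, ENNReal.add_iInf]
  refine le_iInf fun c => le_iInf fun d => le_iInf fun γ' => le_iInf fun hγ' =>
    le_iInf fun a => le_iInf fun b => le_iInf fun γ => le_iInf fun hγ => ?_
  have hs := gfCurves_shift (c - b) hγ'
  rw [sub_sub_cancel] at hs
  have hc := gfCurves_concatenation hγ hs
  refine iInf_le_of_le a <| iInf_le_of_le _ <| iInf_le_of_le _ <| iInf_le_of_le hc ?_
  rw [← Ioc_union_Ioc_eq_Ioc hγ.1.le hs.1.le,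
    lintegral_union measurableSet_Ioc (Ioc_disjoint_Ioc_of_le le_rfl)]
  refine add_le_add (le_of_eq ?_) (le_of_eq ?_)
  · exact setLIntegral_congr_fun measurableSet_Ioc fun s hs => by simp [hs.2]
  · have h1 : Ioc b (d - (c - b)) = (fun s => s + (c - b)) ⁻¹' Ioc c d := by
      rw [preimage_add_const_Ioc, sub_sub_cancel]
    rw [← (measurePreserving_add_right volume (c - b)).setLIntegral_comp_preimage_emb
      (MeasurableEquiv.addRight (c - b)).measurableEmbedding _ (Ioc c d), ← h1]
    exact setLIntegral_congr_fun measurableSet_Ioc fun s hs => by simp [hs.1.not_ge]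

/-! ### Estimates for the action -/

/-- Every curve of finite length can be traversed at a cost close to `∫ |∂E_t| |φ̇|`, with speed at
most `|∂E_t| + 1` inside the interval. -/
theorem exists_mem_gfCurves_lintegral_le {E : ℝ → X → ℝ} {t : ℝ}
    (hfin : ∀ x, descSlope (E t) x ≠ ∞) (hcont : Continuous (descSlope (E t)))
    {φ : ℝ → X} {a b : ℝ} (hab : a < b) (hφ : AbsolutelyContinuousOnInterval φ a b)
    (hlen : metricLength φ a b ≠ ∞) {p₁ p₂ : GFPhase X} (h₁ : φ a = p₁.fst) (h₂ : φ b = p₂.fst)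
    {ε : ℝ} (hε : 0 < ε) :
    ∃ (ℓ : ℝ) (γ : ℝ → GFPhase X), γ ∈ gfCurves p₁ p₂ 0 ℓ ∧
      (∀ s ∈ Icc 0 ℓ, (γ s).fst ∈ φ '' Icc a b ∧ (γ s = p₁ ∨ γ s = p₂ ∨
        ((γ s).snd : ℝ) ≤ (descSlope (E t) (γ s).fst).toReal + 1)) ∧
      ∫⁻ s in Ioc 0 ℓ, (gfPrice E t (γ s) : ℝ≥0∞) ≤
        (∫⁻ s in Ioc a b, descSlope (E t) (φ s) * metricSpeed φ s) + ENNReal.ofReal ε := by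
  set g : X → ℝ := fun x => (descSlope (E t) x).toReal with hg
  have hg0 : ∀ x, 0 ≤ g x := fun x => ENNReal.toReal_nonneg
  have hgE : ∀ x, ENNReal.ofReal (g x) = descSlope (E t) x := fun x =>
    ENNReal.ofReal_toReal (hfin x)
  obtain ⟨δ, ℓ, ψ, hδ, hδ1, hℓ, h0, h1, him, ⟨K, hK⟩, hsp, hint⟩ :=
    exists_almost_optimal_reparametrization hab hφ hlen
      (continuous_toReal_descSlope hfin hcont) hg0 hε
  have hψ : AbsolutelyContinuousOnInterval ψ 0 ℓ :=
    (hK.lipschitzOnWith).absolutelyContinuousOnInterval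
  have hw : ∀ s, metricSpeed ψ s ≤ ENNReal.ofReal (g (ψ s) + δ) := fun s =>
    metricSpeed_le_of_eventually (by linarith [hg0 (ψ s)]) (hsp s)
  have hdiss : gfDissipation E t ψ 0 ℓ ≤ ∫⁻ u in Ioc 0 ℓ, ENNReal.ofReal (g (ψ u) + δ) ^ 2 := by
    rw [gfDissipation, ← lintegral_const_mul' _ _ (by simp)]
    refine lintegral_mono fun s => half_sq_add_sq_le ?_ (hw s)
    rw [← hgE]
    exact ENNReal.ofReal_le_ofReal (by linarith)
  have hlenψ : metricLength ψ 0 ℓ ≠ ∞ := by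
    have hc : Continuous fun s => g (ψ s) + δ :=
      ((continuous_toReal_descSlope hfin hcont).comp hK.continuous).add continuous_const
    refine ne_top_of_le_ne_top ?_ (lintegral_mono hw)
    rw [← ofReal_integral_eq_lintegral_ofReal hc.integrableOn_Ioc
      (Eventually.of_forall fun s => by simp only [Pi.zero_apply]; linarith [hg0 (ψ s)])]
    exact ENNReal.ofReal_ne_top
  have hmem := phaseLift_mem_gfCurves hℓ hψ hlenψ (p₁ := p₁) (p₂ := p₂) (h0.trans h₁) (h1.trans h₂)
  refine ⟨ℓ, _, hmem, fun s hs => ⟨him s, ?_⟩, ?_⟩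
  · rcases hs.1.eq_or_lt with rfl | hs0
    · exact Or.inl hmem.2.1
    rcases hs.2.eq_or_lt with rfl | hs1
    · exact Or.inr (Or.inl hmem.2.2.1)
    refine Or.inr (Or.inr ?_)
    rw [phaseLift_snd_of_mem_Ioo ⟨hs0, hs1⟩]
    have : ((metricSpeed ψ s).toNNReal : ℝ) ≤ g (ψ s) + δ :=
      ENNReal.toReal_le_of_le_ofReal (by linarith [hg0 (ψ s)]) (hw s)
    refine this.trans ?_
    change g (ψ s) + δ ≤ g (ψ s) + 1
    linarith
  · rw [lintegral_gfPrice hfin hmem.2.2.2.2]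
    refine hdiss.trans (hint.trans_eq ?_)
    congr 1
    exact lintegral_congr fun s => by rw [hgE]

theorem gfAction_le_lintegral {E : ℝ → X → ℝ} {t : ℝ}
    (hfin : ∀ x, descSlope (E t) x ≠ ∞) (hcont : Continuous (descSlope (E t)))
    {φ : ℝ → X} {a b : ℝ} (hab : a < b) (hφ : AbsolutelyContinuousOnInterval φ a b)
    (hlen : metricLength φ a b ≠ ∞) :
    gfAction E t (φ a) (φ b) ≤ ∫⁻ s in Ioc a b, descSlope (E t) (φ s) * metricSpeed φ s := by
  refine ENNReal.le_of_forall_pos_le_add fun ε hε _ => ?_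
  obtain ⟨ℓ, γ, hγ, -, hle⟩ := exists_mem_gfCurves_lintegral_le hfin hcont hab hφ hlen
    (p₁ := gfEmbedding (φ a)) (p₂ := gfEmbedding (φ b)) rfl rfl (ε := ε) (by simpa using hε)
  rw [ENNReal.ofReal_coe_nnreal] at hle
  refine le_trans ?_ hle
  have := phaseAction_eq_gfAction hfin (gfEmbedding (φ a)) (gfEmbedding (φ b))
  rw [show gfAction E t (φ a) (φ b) = _ from this.symm]
  exact iInf_le_of_le 0 <| iInf_le_of_le ℓ <| iInf_le_of_le γ <| iInf_le _ hγ

/-- Moving along a nearly shortest curve shows that the action is small between nearby points, and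
of second order near critical points. -/
theorem gfAction_le_mul_dist {E : ℝ → X → ℝ} {t : ℝ}
    (hfin : ∀ x, descSlope (E t) x ≠ ∞) (hcont : Continuous (descSlope (E t)))
    (hpath : IsPathMetric X) {L : ℝ} (hL : 0 ≤ L)
    (hlip : ∀ x y, |(descSlope (E t) x).toReal - (descSlope (E t) y).toReal| ≤ L * dist x y)
    (x y : X) :
    gfAction E t x y ≤
      ENNReal.ofReal (((descSlope (E t) x).toReal + L * dist x y) * dist x y) := by
  set G := (descSlope (E t) x).toReal with hG
  have hG0 : 0 ≤ G := ENNReal.toReal_nonneg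
  have hcts : Tendsto (fun ε => ENNReal.ofReal ((G + L * (dist x y + ε)) * (dist x y + ε)))
      (𝓝[>] 0) (𝓝 (ENNReal.ofReal ((G + L * dist x y) * dist x y))) := by
    have : Continuous fun ε : ℝ => ENNReal.ofReal ((G + L * (dist x y + ε)) * (dist x y + ε)) :=
      ENNReal.continuous_ofReal.comp (by fun_prop)
    simpa using (this.tendsto 0).mono_left nhdsWithin_le_nhds
  refine ge_of_tendsto hcts ?_
  filter_upwards [self_mem_nhdsWithin] with ε (hε : 0 < ε)
  set D := dist x y + ε with hD
  have hD0 : 0 < D := by positivity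
  have hlt : edist x y < ENNReal.ofReal D := by
    rw [edist_dist]; exact (ENNReal.ofReal_lt_ofReal_iff hD0).2 (by linarith)
  rw [hpath x y] at hlt
  simp only [iInf_lt_iff] at hlt
  obtain ⟨η, ⟨hη, h0, h1⟩, hlen⟩ := hlt
  have hnear : ∀ s ∈ Ioc (0 : ℝ) 1, descSlope (E t) (η s) ≤ ENNReal.ofReal (G + L * D) := by
    intro s hs
    have hd : dist (η s) x ≤ D := by
      have e1 : edist (η 0) (η s) ≤ metricLength η 0 s :=
        edist_le_metricLength hs.1.le (hη.mono (by
          rw [uIcc_of_le hs.1.le, uIcc_of_le zero_le_one]; exact Icc_subset_Icc_right hs.2))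
      have e2 : metricLength η 0 s ≤ metricLength η 0 1 :=
        lintegral_mono_set (Ioc_subset_Ioc_right hs.2)
      have e3 := (e1.trans e2).trans hlen.le
      rw [h0, edist_dist] at e3
      rw [dist_comm]
      exact (ENNReal.ofReal_le_ofReal_iff hD0.le).1 e3
    rw [← ENNReal.ofReal_toReal (hfin (η s))]
    refine ENNReal.ofReal_le_ofReal ?_
    have h2 := (abs_le.1 (hlip (η s) x)).2
    have h3 : L * dist (η s) x ≤ L * D := by gcongr
    linarith
  calc gfAction E t x y = gfAction E t (η 0) (η 1) := by rw [h0, h1]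
    _ ≤ ∫⁻ s in Ioc 0 1, descSlope (E t) (η s) * metricSpeed η s :=
        gfAction_le_lintegral hfin hcont zero_lt_one hη (hlen.trans_le le_top).ne
    _ ≤ ∫⁻ s in Ioc 0 1, ENNReal.ofReal (G + L * D) * metricSpeed η s := by
        refine setLIntegral_mono' measurableSet_Ioc fun s hs => ?_
        gcongr
        exact hnear s hs
    _ = ENNReal.ofReal (G + L * D) * metricLength η 0 1 :=
        lintegral_const_mul' _ _ ENNReal.ofReal_ne_top
    _ ≤ ENNReal.ofReal (G + L * D) * ENNReal.ofReal D := by gcongr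
    _ = _ := (ENNReal.ofReal_mul (by positivity)).symm

theorem gfAction_le_mul_dist_right {E : ℝ → X → ℝ} {t : ℝ}
    (hfin : ∀ x, descSlope (E t) x ≠ ∞) (hcont : Continuous (descSlope (E t)))
    (hpath : IsPathMetric X) {L : ℝ} (hL : 0 ≤ L)
    (hlip : ∀ x y, |(descSlope (E t) x).toReal - (descSlope (E t) y).toReal| ≤ L * dist x y)
    (x y : X) :
    gfAction E t x y ≤
      ENNReal.ofReal (((descSlope (E t) y).toReal + 2 * L * dist x y) * dist x y) := by
  refine (gfAction_le_mul_dist hfin hcont hpath hL hlip x y).trans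
    (ENNReal.ofReal_le_ofReal (mul_le_mul_of_nonneg_right ?_ dist_nonneg))
  linarith [(abs_le.1 (hlip x y)).2]

/-- The action is controlled by the distance near the diagonal, so the triangle inequality gives
lower semicontinuity. -/
theorem lowerSemicontinuous_gfAction {E : ℝ → X → ℝ} {t : ℝ}
    (hfin : ∀ x, descSlope (E t) x ≠ ∞) (hcont : Continuous (descSlope (E t)))
    (hpath : IsPathMetric X) {L : ℝ} (hL : 0 ≤ L)
    (hlip : ∀ x y, |(descSlope (E t) x).toReal - (descSlope (E t) y).toReal| ≤ L * dist x y) :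
    LowerSemicontinuous fun q : X × X => gfAction E t q.1 q.2 := by
  rintro ⟨x, y⟩ c (hc : c < gfAction E t x y)
  set A := (descSlope (E t) x).toReal with hA
  set B := (descSlope (E t) y).toReal with hB
  have hsmall : Tendsto (fun q : X × X => c +
      (ENNReal.ofReal ((A + L * dist x q.1) * dist x q.1) +
      ENNReal.ofReal ((B + 2 * L * dist q.2 y) * dist q.2 y))) (𝓝 (x, y)) (𝓝 c) := by
    have hc1 : Continuous fun q : X × X => (A + L * dist x q.1) * dist x q.1 := by fun_prop
    have hc2 : Continuous fun q : X × X => (B + 2 * L * dist q.2 y) * dist q.2 y := by fun_prop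
    have hc3 : Continuous fun q : X × X => c +
        (ENNReal.ofReal ((A + L * dist x q.1) * dist x q.1) +
        ENNReal.ofReal ((B + 2 * L * dist q.2 y) * dist q.2 y)) :=
      continuous_const.add ((ENNReal.continuous_ofReal.comp hc1).add
        (ENNReal.continuous_ofReal.comp hc2))
    simpa using hc3.tendsto (x, y)
  filter_upwards [hsmall.eventually_lt_const hc] with q hq
  have h1 := gfAction_le_mul_dist hfin hcont hpath hL hlip x q.1
  have h2 := gfAction_le_mul_dist_right hfin hcont hpath hL hlip q.2 y
  have h3 : gfAction E t x y ≤ gfAction E t q.1 q.2 +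
      (gfAction E t x q.1 + gfAction E t q.2 y) :=
    calc gfAction E t x y ≤ gfAction E t x q.1 + gfAction E t q.1 y :=
          gfAction_triangle hfin _ _ _
      _ ≤ gfAction E t x q.1 + (gfAction E t q.1 q.2 + gfAction E t q.2 y) :=
          add_le_add le_rfl (gfAction_triangle hfin _ _ _)
      _ = _ := by rw [add_left_comm]
  exact lt_of_add_lt_add_right (hq.trans_le (h3.trans (add_le_add le_rfl (add_le_add h1 h2))))

theorem RegularEnergy.continuous_descSlope {T : ℝ} {E : ℝ → X → ℝ} (hreg : RegularEnergy T E)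
    {t : ℝ} (ht : t ∈ Icc 0 T) : Continuous (descSlope (E t)) :=
  ContinuousOn.comp_continuous (f := fun x : X => (t, x)) hreg.continuousOn_slope
    (Continuous.prodMk_right t) fun _ => ⟨ht, mem_univ _⟩

theorem RegularEnergy.continuous {T : ℝ} {E : ℝ → X → ℝ} (hreg : RegularEnergy T E)
    {t : ℝ} (ht : t ∈ Icc 0 T) : Continuous (E t) :=
  ContinuousOn.comp_continuous (f := fun x : X => (t, x)) hreg.continuousOn
    (Continuous.prodMk_right t) fun _ => ⟨ht, mem_univ _⟩

theorem isAction_gfAction {T : ℝ} {E : ℝ → X → ℝ} (hreg : RegularEnergy T E)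
    (hpath : IsPathMetric X) (hlip : SlopeLipschitz T E) : IsAction T E (gfAction E) := by
  obtain ⟨L, hL, hlip⟩ := hlip
  have hne : ∀ t ∈ Icc 0 T, ∀ x y, gfAction E t x y ≠ ∞ := fun t ht x y =>
    ne_top_of_le_ne_top ENNReal.ofReal_ne_top (gfAction_le_mul_dist (hreg.slope_ne_top t ht)
      (hreg.continuous_descSlope ht) hpath hL.le (hlip t ht) x y)
  refine ⟨hne, fun t ht => lowerSemicontinuous_gfAction (hreg.slope_ne_top t ht)
    (hreg.continuous_descSlope ht) hpath hL.le (hlip t ht), fun t ht x y => ?_⟩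
  rw [← ENNReal.ofReal_le_iff_le_toReal (hne t ht x y)]
  exact ofReal_sub_le_gfAction (hreg.slope_ne_top t ht) (hreg.continuous_descSlope ht)
    (hreg.continuous ht) (fun _ => le_rfl) x y

/-- Along the curve of the transition rule the energy drop is the dissipation, which is at least the
action; lower semicontinuity of the action preserves this in the limit. -/
theorem isCompatible_gfAction {T : ℝ} {E : ℝ → X → ℝ} (hreg : RegularEnergy T E)
    (hact : IsAction T E (gfAction E)) {ω : ℝ → X → X} (hω : IsGFTransitionRule T E ω) :
    IsCompatible T E (gfAction E) ω := by
  refine ⟨hact, fun t ht x => le_antisymm (hact.energy_le t ht x _) ?_⟩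
  obtain ⟨φ, σ, hφ, hσ0, -, hσ, h0, hlim, hE⟩ := hω t ht x
  have hEt : Continuous (E t) := hreg.continuous ht
  refine ENNReal.toReal_le_of_le_ofReal ?_ ?_
  · refine ge_of_tendsto (tendsto_const_nhds.sub ((hEt.tendsto _).comp hlim))
      (Eventually.of_forall fun k => ?_)
    simp only [Function.comp_apply, (hE _ (hσ0 k)).2, ENNReal.toReal_nonneg]
  · have hlim' : Tendsto (fun k => ENNReal.ofReal (E t x - E t (φ (σ k)))) atTop
        (𝓝 (ENNReal.ofReal (E t x - E t (ω t x)))) :=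
      ENNReal.tendsto_ofReal (tendsto_const_nhds.sub ((hEt.tendsto _).comp hlim))
    refine le_of_forall_lt fun c hc => ?_
    have hq : Tendsto (fun k => (x, φ (σ k))) atTop (𝓝 (x, ω t x)) :=
      tendsto_const_nhds.prodMk_nhds hlim
    obtain ⟨d, hcd, hd⟩ := exists_between hc
    refine hcd.trans_le (ge_of_tendsto hlim' ?_)
    filter_upwards [hq.eventually (hact.lowerSemicontinuous t ht (x, ω t x) d hd),
      hσ.eventually_gt_atTop 0] with k hk hk0
    have h1 := gfAction_le (E := E) (t := t) hk0 (hφ _ hk0.le)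
    rw [h0] at h1
    rw [(hE _ hk0.le).2, ENNReal.ofReal_toReal (hE _ hk0.le).1]
    exact (hk.trans_le h1).le

/-- Crossing a layer `{α ≤ u ≤ β}` on which the slope is at least `δ` costs at least `δ (β - α)`:
the function `-δ u`, truncated outside the layer, has slope at most `|∂E_t|`. -/
theorem ofReal_mul_le_gfAction {E : ℝ → X → ℝ} {t : ℝ}
    (hfin : ∀ x, descSlope (E t) x ≠ ∞) (hcont : Continuous (descSlope (E t)))
    {u : X → ℝ} (hu : LipschitzWith 1 u) {α β δ : ℝ} (hαβ : α ≤ β) (hδ : 0 ≤ δ)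
    (h : ∀ x, α ≤ u x → u x ≤ β → ENNReal.ofReal δ ≤ descSlope (E t) x)
    {x y : X} (hx : u x ≤ α) (hy : β ≤ u y) :
    ENNReal.ofReal (δ * (β - α)) ≤ gfAction E t x y := by
  have hlip : LipschitzWith 1 fun z => max α (min (u z) β) := (hu.min_const β).const_max α
  have key := ofReal_sub_le_gfAction hfin hcont (f := fun z => -(δ * max α (min (u z) β)))
    (continuous_const.mul hlip.continuous).neg ?_ x y
  · have e1 : max α (min (u x) β) = α := max_eq_left ((min_le_left _ _).trans hx)
    have e2 : max α (min (u y) β) = β := by rw [min_eq_right hy, max_eq_right hαβ]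
    simp only [e1, e2] at key
    rwa [show -(δ * α) - -(δ * β) = δ * (β - α) by ring] at key
  · intro z
    have hconst : ∀ c, (∀ᶠ w in 𝓝 z, max α (min (u w) β) = c) →
        descSlope (fun z => -(δ * max α (min (u z) β))) z ≤ descSlope (E t) z := fun c hc => by
      refine le_trans (descSlope_le_of_eventually (C := 0) ?_) (by simp)
      filter_upwards [hc] with w hw
      simp [hw, hc.self_of_nhds]
    rcases lt_or_ge (u z) α with h1 | h1
    · refine hconst α ?_
      filter_upwards [hu.continuous.continuousAt.eventually_lt_const h1] with w hw
      exact max_eq_left ((min_le_left _ _).trans hw.le)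
    rcases lt_or_ge β (u z) with h2 | h2
    · refine hconst β ?_
      filter_upwards [hu.continuous.continuousAt.eventually_const_lt h2] with w hw
      rw [min_eq_right hw.le, max_eq_right hαβ]
    · refine (descSlope_le_of_eventually (Eventually.of_forall fun w => ?_)).trans (h z h1 h2)
      have h3 := hlip.dist_le_mul w z
      rw [NNReal.coe_one, one_mul, Real.dist_eq, dist_comm] at h3
      calc -(δ * max α (min (u z) β)) - -(δ * max α (min (u w) β))
          = δ * (max α (min (u w) β) - max α (min (u z) β)) := by ring
        _ ≤ δ * dist z w := by gcongr; exact (le_abs_self _).trans h3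

/-! ### Compactness -/

/-- Gronwall's inequality for `t ↦ E_t(x) + C₂ / C₁`. -/
theorem energy_add_le_exp_mul {Y : Type*} {T : ℝ} {E : ℝ → Y → ℝ} {C₁ C₂ : ℝ} (hC₁ : 0 < C₁) {x : Y}
    (hdiff : DifferentiableOn ℝ (fun t => E t x) (Icc 0 T))
    (hpow : ∀ t ∈ Icc 0 T, |derivWithin (fun s => E s x) (Icc 0 T) t| ≤ C₁ * E t x + C₂)
    {s t : ℝ} (hs : s ∈ Icc 0 T) (ht : t ∈ Icc 0 T) :
    E s x + C₂ / C₁ ≤ Real.exp (C₁ * T) * (E t x + C₂ / C₁) := by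
  set f : ℝ → ℝ := fun r => E r x + C₂ / C₁ with hf
  have hf0 : ∀ r ∈ Icc 0 T, 0 ≤ f r := fun r hr => by
    have h := (abs_nonneg _).trans (hpow r hr)
    have h2 : C₁ * f r = C₁ * E r x + C₂ := by simp only [hf]; field_simp
    exact nonneg_of_mul_nonneg_right (h2 ▸ h) hC₁
  have hfc : ContinuousOn f (Icc 0 T) := hdiff.continuousOn.add continuousOn_const
  have hfd : ∀ r ∈ interior (Icc 0 T), ∃ d, HasDerivAt f d r ∧ |d| ≤ C₁ * f r := by
    intro r hr
    rw [interior_Icc] at hr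
    have hr' : r ∈ Icc 0 T := Ioo_subset_Icc_self hr
    refine ⟨_, ((hdiff r hr').hasDerivWithinAt.hasDerivAt (Icc_mem_nhds hr.1 hr.2)).add_const _, ?_⟩
    refine (hpow r hr').trans_eq ?_
    simp only [hf]; field_simp
  have hexp : ∀ c r : ℝ, HasDerivAt (fun r => Real.exp (c * r)) (Real.exp (c * r) * c) r :=
    fun c r => by simpa using ((hasDerivAt_id r).const_mul c).exp
  have hanti : AntitoneOn (fun r => f r * Real.exp (-C₁ * r)) (Icc 0 T) := by
    refine antitoneOn_of_deriv_nonpos (convex_Icc 0 T) (hfc.mul (by fun_prop)) ?_ ?_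
    · intro r hr
      obtain ⟨d, hd, -⟩ := hfd r hr
      exact (hd.mul (hexp _ r)).differentiableAt.differentiableWithinAt
    · intro r hr
      obtain ⟨d, hd, hd2⟩ := hfd r hr
      rw [(hd.fun_mul (hexp (-C₁) r)).deriv]
      have := mul_le_mul_of_nonneg_right ((le_abs_self d).trans hd2) (Real.exp_pos (-C₁ * r)).le
      linarith
  have hmono : MonotoneOn (fun r => f r * Real.exp (C₁ * r)) (Icc 0 T) := by
    refine monotoneOn_of_deriv_nonneg (convex_Icc 0 T) (hfc.mul (by fun_prop)) ?_ ?_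
    · intro r hr
      obtain ⟨d, hd, -⟩ := hfd r hr
      exact (hd.mul (hexp _ r)).differentiableAt.differentiableWithinAt
    · intro r hr
      obtain ⟨d, hd, hd2⟩ := hfd r hr
      rw [(hd.fun_mul (hexp C₁ r)).deriv]
      have := mul_le_mul_of_nonneg_right ((neg_le_abs d).trans hd2) (Real.exp_pos (C₁ * r)).le
      linarith
  -- Used with `c = C₁` if `s ≤ t` and with `c = -C₁` if `t ≤ s`.
  have hcase : ∀ c, f s * Real.exp (c * s) ≤ f t * Real.exp (c * t) → c * (t - s) ≤ C₁ * T →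
      f s ≤ Real.exp (C₁ * T) * f t := by
    intro c h1 h2
    have h3 : f s = f s * Real.exp (c * s) * Real.exp (-(c * s)) := by
      rw [mul_assoc, ← Real.exp_add, add_neg_cancel, Real.exp_zero, mul_one]
    calc f s = f s * Real.exp (c * s) * Real.exp (-(c * s)) := h3
      _ ≤ f t * Real.exp (c * t) * Real.exp (-(c * s)) := by gcongr
      _ = Real.exp (c * (t - s)) * f t := by
          rw [mul_assoc, ← Real.exp_add, mul_comm]; ring_nf
      _ ≤ Real.exp (C₁ * T) * f t := by
          gcongr
          exact hf0 t ht
  rcases le_total s t with h | h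
  · refine hcase C₁ (hmono hs ht h) ?_
    gcongr
    linarith [hs.1, ht.2]
  · refine hcase (-C₁) (hanti ht hs h) ?_
    have : C₁ * (s - t) ≤ C₁ * T := by gcongr; linarith [ht.1, hs.2]
    linarith

/-- A bound for the energy at one time bounds it at all times. -/
theorem exists_iSup_abs_le {T : ℝ} (hT : 0 < T) {E : ℝ → X → ℝ} (hreg : RegularEnergy T E)
    (hpow : PowerControl T E) (C : ℝ) :
    ∃ C' : ℝ, ∀ t ∈ Icc 0 T, ∀ x, E t x ≤ C → (⨆ s : Icc (0 : ℝ) T, |E s x|) ≤ C' := by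
  obtain ⟨C₁, C₂, hC₁, hC₂, hpow⟩ := hpow
  refine ⟨Real.exp (C₁ * T) * (C + C₂ / C₁) + C₂ / C₁, fun t ht x hx => ?_⟩
  have : Nonempty (Icc (0 : ℝ) T) := ⟨⟨0, le_rfl, hT.le⟩⟩
  have hc : 0 < C₂ / C₁ := div_pos hC₂ hC₁
  refine ciSup_le fun s => ?_
  have h1 := energy_add_le_exp_mul hC₁ (hreg.differentiable x) (fun t ht => hpow t ht x) s.2 ht
  have h2 : Real.exp (C₁ * T) * (E t x + C₂ / C₁) ≤ Real.exp (C₁ * T) * (C + C₂ / C₁) := by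
    gcongr
  have h3 : 0 ≤ E s x + C₂ / C₁ := by
    have h := (abs_nonneg _).trans (hpow s s.2 x)
    have h2 : C₁ * (E s x + C₂ / C₁) = C₁ * E s x + C₂ := by field_simp
    exact nonneg_of_mul_nonneg_right (h2 ▸ h) hC₁
  exact abs_le.2 ⟨by linarith, by linarith⟩

/-- Bounded sets have bounded energy, so coercivity makes closed balls compact. -/
theorem properSpace_of_uniformlyCoercive {T : ℝ} (hT : 0 < T) {E : ℝ → X → ℝ}
    (hreg : RegularEnergy T E) (hpow : PowerControl T E) (hcoer : UniformlyCoercive T E)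
    (hpath : IsPathMetric X) (hlip : SlopeLipschitz T E) : ProperSpace X := by
  have hact := isAction_gfAction hreg hpath hlip
  obtain ⟨L, hL, hlip⟩ := hlip
  have h0 : (0 : ℝ) ∈ Icc 0 T := ⟨le_rfl, hT.le⟩
  refine ⟨fun x₀ r => ?_⟩
  set G := (descSlope (E 0) x₀).toReal with hG
  have hG0 : 0 ≤ G := ENNReal.toReal_nonneg
  obtain ⟨C', hC'⟩ := exists_iSup_abs_le hT hreg hpow (E 0 x₀ + (G + 2 * L * |r|) * |r|)
  refine (hcoer C').of_isClosed_subset Metric.isClosed_closedBall fun x hx => ?_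
  refine hC' 0 h0 x ?_
  have hd : dist x x₀ ≤ |r| := (Metric.mem_closedBall.1 hx).trans (le_abs_self r)
  have h1 := hact.energy_le 0 h0 x x₀
  have h2 : (gfAction E 0 x x₀).toReal ≤ (G + 2 * L * dist x x₀) * dist x x₀ :=
    ENNReal.toReal_le_of_le_ofReal (by positivity)
      (gfAction_le_mul_dist_right (hreg.slope_ne_top 0 h0) (hreg.continuous_descSlope h0) hpath
        hL.le (hlip 0 h0) x x₀)
  have h3 : (G + 2 * L * dist x x₀) * dist x x₀ ≤ (G + 2 * L * |r|) * |r| := by gcongr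
  linarith

/-! ### Points at zero action -/

/-- The slope is bounded below on a ball around a point that is not critical, and a curve that joins
this point to another one has to cross such a ball. -/
theorem gfAction_ne_zero_of_descSlope_ne_zero {E : ℝ → X → ℝ} {t : ℝ}
    (hfin : ∀ x, descSlope (E t) x ≠ ∞) (hcont : Continuous (descSlope (E t))) {z : X}
    (hz : descSlope (E t) z ≠ 0) {x y : X} (hxy : x ≠ y) (h : z = x ∨ z = y) :
    gfAction E t x y ≠ 0 := by
  set δ := (descSlope (E t) z).toReal / 2 with hδ
  have hg0 : 0 < (descSlope (E t) z).toReal := ENNReal.toReal_pos hz (hfin z)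
  have hδ0 : 0 < δ := half_pos hg0
  have hlt : ENNReal.ofReal δ < descSlope (E t) z := by
    rw [ENNReal.ofReal_lt_iff_lt_toReal hδ0.le (hfin z)]
    exact half_lt_self hg0
  obtain ⟨ε, hε, hball⟩ :=
    Metric.eventually_nhds_iff_ball.1 (hcont.continuousAt.eventually_const_lt hlt)
  set ρ := min (ε / 2) (dist x y) with hρ
  have hρ0 : 0 < ρ := lt_min (half_pos hε) (dist_pos.2 hxy)
  have hball' : ∀ w, dist w z ≤ ρ → ENNReal.ofReal δ ≤ descSlope (E t) w := fun w hw =>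
    (hball w (lt_of_le_of_lt (hw.trans (min_le_left _ _)) (half_lt_self hε))).le
  suffices h' : ENNReal.ofReal (δ * ρ) ≤ gfAction E t x y from
    (lt_of_lt_of_le (by simpa using mul_pos hδ0 hρ0) h').ne'
  rcases h with rfl | rfl
  · have := ofReal_mul_le_gfAction hfin hcont (LipschitzWith.dist_left z) hρ0.le hδ0.le
      (fun w _ hw => hball' w hw) (x := z) (y := y) (by simp)
      (by rw [dist_comm]; exact min_le_right _ _)
    rwa [sub_zero] at this
  · have hneg : LipschitzWith 1 fun w => -dist w z := (LipschitzWith.dist_left z).neg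
    have := ofReal_mul_le_gfAction hfin hcont hneg (neg_nonpos.2 hρ0.le) hδ0.le
      (fun w hw _ => hball' w (neg_le_neg_iff.1 hw)) (x := x) (y := z)
      (neg_le_neg (min_le_right _ _)) (by simp)
    rwa [zero_sub, neg_neg] at this

/-- A rectifiable path of critical points can be subdivided into short steps. The action of each
step is quadratic in its length, so the total is small. -/
theorem gfAction_eq_zero_of_rectifiablyPathConnected {E : ℝ → X → ℝ} {t : ℝ}
    (hfin : ∀ x, descSlope (E t) x ≠ ∞) (hcont : Continuous (descSlope (E t)))
    (hpath : IsPathMetric X) {L : ℝ} (hL : 0 < L)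
    (hlip : ∀ x y, |(descSlope (E t) x).toReal - (descSlope (E t) y).toReal| ≤ L * dist x y)
    {A : Set X} (hA : RectifiablyPathConnected A) (hAcrit : A ⊆ criticalSet (E t)) {x y : X}
    (hx : x ∈ A) (hy : y ∈ A) : gfAction E t x y = 0 := by
  obtain ⟨η, hη, hmaps, rfl, rfl, hvar⟩ := hA x hx y hy
  have hstep : ∀ p ∈ A, ∀ q ε, dist p q ≤ ε →
      gfAction E t p q ≤ ENNReal.ofReal (L * ε) * edist p q := by
    intro p hp q ε hd
    refine (gfAction_le_mul_dist hfin hcont hpath hL.le hlip p q).trans ?_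
    have h0 : descSlope (E t) p = 0 := hAcrit hp
    have hε : 0 ≤ ε := dist_nonneg.trans hd
    rw [h0, ENNReal.toReal_zero, zero_add, edist_dist, ← ENNReal.ofReal_mul (by positivity)]
    exact ENNReal.ofReal_le_ofReal (by gcongr)
  have hle : ∀ ε > 0, gfAction E t (η 0) (η 1) ≤
      ENNReal.ofReal (L * ε) * eVariationOn η (Icc 0 1) := by
    intro ε hε
    obtain ⟨δ, hδ, huc⟩ := Metric.uniformContinuousOn_iff_le.1
      (isCompact_Icc.uniformContinuousOn_of_continuous hη) ε hε
    obtain ⟨n, hn⟩ := exists_nat_one_div_lt hδ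
    set N : ℝ := (n : ℝ) + 1 with hN
    have hN0 : 0 < N := by positivity
    set u : ℕ → ℝ := fun i => i / N with hu
    have humem : ∀ i ≤ n + 1, u i ∈ Icc (0 : ℝ) 1 := fun i hi => by
      refine ⟨by positivity, (div_le_one hN0).2 ?_⟩
      rw [hN]; exact_mod_cast hi
    have humono : Monotone u := fun i j hij => by
      simp only [hu]; gcongr
    have hsum : ∀ k ≤ n + 1, gfAction E t (η (u 0)) (η (u k)) ≤
        ∑ i ∈ Finset.range k, ENNReal.ofReal (L * ε) * edist (η (u (i + 1))) (η (u i)) := by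
      intro k
      induction k with
      | zero =>
        intro _
        simpa using hstep _ (hmaps (humem 0 (Nat.zero_le _))) (η (u 0)) 0 (by simp)
      | succ k ih =>
        intro hk
        rw [Finset.sum_range_succ]
        refine (gfAction_triangle hfin _ (η (u k)) _).trans
          (add_le_add (ih (Nat.le_of_succ_le hk)) ?_)
        rw [edist_comm]
        refine hstep _ (hmaps (humem k (Nat.le_of_succ_le hk))) _ _
          (huc _ (humem k (Nat.le_of_succ_le hk)) _ (humem _ hk) ?_)
        have : u k - u (k + 1) = -(1 / N) := by simp only [hu]; push_cast; ring
        rw [Real.dist_eq, this, abs_neg, abs_of_pos (by positivity)]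
        exact hn.le
    have h0 : u 0 = 0 := by simp [hu]
    have h1 : u (n + 1) = 1 := by simp only [hu, hN]; push_cast; field_simp
    have hfinal := hsum (n + 1) le_rfl
    rw [h0, h1, ← Finset.mul_sum] at hfinal
    refine hfinal.trans ?_
    gcongr
    exact eVariationOn.sum_le_of_monotoneOn_Iic (humono.monotoneOn _) humem
  have hlim : Tendsto (fun ε => ENNReal.ofReal (L * ε) * eVariationOn η (Icc 0 1)) (𝓝[>] 0)
      (𝓝 0) := by
    have h1 : Tendsto (fun ε => ENNReal.ofReal (L * ε)) (𝓝[>] 0) (𝓝 0) := by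
      have : Continuous fun ε : ℝ => ENNReal.ofReal (L * ε) :=
        ENNReal.continuous_ofReal.comp (by fun_prop)
      simpa using (this.tendsto 0).mono_left nhdsWithin_le_nhds
    simpa using ENNReal.Tendsto.mul_const h1 (Or.inr hvar)
  exact le_antisymm (ge_of_tendsto hlim (eventually_mem_nhdsWithin.mono fun ε hε => hle ε hε))
    bot_le

/-- A compact isolated part `A` of the critical set is surrounded by a layer without critical
points, which can only be crossed at a positive cost. -/
theorem mem_of_gfAction_eq_zero [ProperSpace X] {E : ℝ → X → ℝ} {t : ℝ}
    (hfin : ∀ x, descSlope (E t) x ≠ ∞) (hcont : Continuous (descSlope (E t)))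
    {A : Set X} (hA : IsCompact A) {r : ℝ} (hr : 0 < r)
    (hsep : ∀ z ∈ criticalSet (E t), z ∉ A → r ≤ Metric.infDist z A)
    {x y : X} (hx : x ∈ A) (hy : y ∈ criticalSet (E t)) (hxy : gfAction E t x y = 0) : y ∈ A := by
  by_contra hyA
  have hu : LipschitzWith 1 fun z => Metric.infDist z A := Metric.lipschitz_infDist_pt A
  set S : Set X := {z | r / 3 ≤ Metric.infDist z A ∧ Metric.infDist z A ≤ 2 * r / 3} with hS
  have hSclosed : IsClosed S :=
    (isClosed_le continuous_const hu.continuous).inter (isClosed_le hu.continuous continuous_const)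
  have hScomp : IsCompact S := by
    refine (hA.cthickening (r := 2 * r / 3)).of_isClosed_subset hSclosed fun z hz => ?_
    exact Metric.mem_cthickening_iff.2
      ((ENNReal.le_ofReal_iff_toReal_le (Metric.infEDist_ne_top ⟨x, hx⟩) (by positivity)).2 hz.2)
  have hpos : ∀ z ∈ S, 0 < (descSlope (E t) z).toReal := by
    intro z hz
    refine ENNReal.toReal_pos (fun h0 => ?_) (hfin z)
    by_cases hzA : z ∈ A
    · have := hz.1
      rw [Metric.infDist_zero_of_mem hzA] at this
      linarith
    · have := hsep z h0 hzA
      linarith [hz.2]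
  obtain ⟨δ, hδ, hδS⟩ : ∃ δ > 0, ∀ z ∈ S, δ ≤ (descSlope (E t) z).toReal := by
    rcases S.eq_empty_or_nonempty with he | hne
    · exact ⟨1, one_pos, fun z hz => by simp [he] at hz⟩
    · obtain ⟨z₀, hz₀, hmin⟩ := hScomp.exists_isMinOn hne
        (continuous_toReal_descSlope hfin hcont).continuousOn
      exact ⟨_, hpos z₀ hz₀, fun z hz => hmin hz⟩
  have hbound := ofReal_mul_le_gfAction hfin hcont hu (α := r / 3) (β := 2 * r / 3)
    (by linarith) hδ.le
    (fun z h1 h2 => (ENNReal.ofReal_le_iff_le_toReal (hfin z)).2 (hδS z ⟨h1, h2⟩)) (x := x) (y := y)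
    (by rw [Metric.infDist_zero_of_mem hx]; positivity) (by linarith [hsep y hy hyA])
  rw [hxy, nonpos_iff_eq_zero, ENNReal.ofReal_eq_zero] at hbound
  have : 0 < δ * (2 * r / 3 - r / 3) := mul_pos hδ (by linarith)
  linarith

/-! ### Generation by curves -/

theorem continuous_gfEmbedding : Continuous (gfEmbedding (X := X)) :=
  (WithLp.prod_continuous_toLp 1 X ℝ≥0).comp (Continuous.prodMk_left 0)

theorem isClosedEmbedding_gfEmbedding : IsClosedEmbedding (gfEmbedding (X := X)) :=
  Function.LeftInverse.isClosedEmbedding (f := fun p : GFPhase X => p.fst) (fun _ => rfl)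
    (WithLp.continuous_fst 1 X ℝ≥0) continuous_gfEmbedding

theorem continuousOn_gfPrice {T : ℝ} {E : ℝ → X → ℝ} (hreg : RegularEnergy T E) :
    ContinuousOn (fun q : GFPhase X × ℝ => gfPrice E q.2 q.1) (univ ×ˢ Icc 0 T) := by
  obtain ⟨S, hS, hSc⟩ : ∃ S : ℝ × X → ℝ≥0,
      (∀ q, S q = (descSlope (E q.1) q.2).toNNReal) ∧ ContinuousOn S (Icc 0 T ×ˢ univ) :=
    ⟨_, fun _ => rfl, ENNReal.continuousOn_toNNReal.comp hreg.continuousOn_slope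
      fun q hq => hreg.slope_ne_top q.1 hq.1 _⟩
  have hc : Continuous fun q : GFPhase X × ℝ => (q.2, q.1.fst) :=
    continuous_snd.prodMk ((WithLp.continuous_fst 1 X ℝ≥0).comp continuous_fst)
  have hslope : ContinuousOn (fun q : GFPhase X × ℝ => S (q.2, q.1.fst)) (univ ×ˢ Icc 0 T) :=
    hSc.comp hc.continuousOn fun q hq => ⟨hq.2, mem_univ _⟩
  have hsnd : Continuous fun q : GFPhase X × ℝ => q.1.snd :=
    (WithLp.continuous_snd 1 X ℝ≥0).comp continuous_fst
  have heq : (fun q : GFPhase X × ℝ => gfPrice E q.2 q.1) =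
      fun q => 2⁻¹ * S (q.2, q.1.fst) ^ 2 + 2⁻¹ * q.1.snd ^ 2 := by
    ext q
    rw [hS, gfPrice]
  rw [heq]
  exact (continuousOn_const.mul (hslope.pow 2)).add
    (continuousOn_const.mul (hsnd.pow 2).continuousOn)

theorem gfPrice_eq_zero_iff {E : ℝ → X → ℝ} {t : ℝ} (hfin : ∀ x, descSlope (E t) x ≠ ∞)
    (p : GFPhase X) : gfPrice E t p = 0 ↔ ∃ x, gfEmbedding x = p ∧ descSlope (E t) x = 0 := by
  have h : gfPrice E t p = 0 ↔ descSlope (E t) p.fst = 0 ∧ p.snd = 0 := by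
    simp [gfPrice, ENNReal.toNNReal_eq_zero_iff, hfin]
  rw [h]
  constructor
  · rintro ⟨h1, h2⟩
    refine ⟨p.fst, ?_, h1⟩
    rw [gfEmbedding, ← h2]
    rfl
  · rintro ⟨x, rfl, hx⟩
    exact ⟨hx, rfl⟩

/-- The members of the decomposition of the critical set are relatively open and closed in it, and
connected, so that the connected component of a critical point is the member containing it. -/
theorem gfAction_eq_zero_iff [ProperSpace X] {T : ℝ} {E : ℝ → X → ℝ} (hreg : RegularEnergy T E)
    (hcrit : CriticalComponents T E) (hpath : IsPathMetric X) (hlip : SlopeLipschitz T E)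
    {t : ℝ} (ht : t ∈ Icc 0 T) {x₁ x₂ : X} (hne : x₁ ≠ x₂) :
    gfAction E t x₁ x₂ = 0 ↔
      gfEmbedding x₂ ∈ connectedComponentIn {p | gfPrice E t p = 0} (gfEmbedding x₁) := by
  obtain ⟨L, hL, hlip⟩ := hlip
  obtain ⟨⟨𝒞, h𝒞, -, hcompact, hsep⟩, -⟩ := hcrit t ht
  have hfin := hreg.slope_ne_top t ht
  have hcont := hreg.continuous_descSlope ht
  have hmemZ : ∀ x, gfEmbedding x ∈ {p | gfPrice E t p = 0} ↔ x ∈ criticalSet (E t) := fun x => by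
    rw [mem_ofPred_eq, gfPrice_eq_zero_iff hfin]
    exact ⟨fun ⟨y, hy, hy0⟩ => (isClosedEmbedding_gfEmbedding.injective hy) ▸ hy0,
      fun h => ⟨x, rfl, h⟩⟩
  -- Critical points outside a member of `𝒞` stay away from it.
  have hfar : ∀ A ∈ 𝒞, A.Nonempty → ∃ r > 0, ∀ z ∈ criticalSet (E t), z ∉ A →
      r ≤ Metric.infDist z A := by
    intro A hA hAne
    obtain ⟨r, hr, h⟩ := hsep A hA
    refine ⟨r, hr, fun z hz hzA => ?_⟩
    rw [← h𝒞] at hz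
    obtain ⟨B, hB, hzB⟩ := hz
    refine (Metric.le_infDist hAne).2 fun y hy => ?_
    rw [dist_comm]
    exact h B hB (fun hBA => hzA (hBA ▸ hzB)) y hy z hzB
  constructor
  · intro h0
    have hx₁ : x₁ ∈ criticalSet (E t) := by
      by_contra hx
      exact gfAction_ne_zero_of_descSlope_ne_zero hfin hcont hx hne (Or.inl rfl) h0
    have hx₂ : x₂ ∈ criticalSet (E t) := by
      by_contra hx
      exact gfAction_ne_zero_of_descSlope_ne_zero hfin hcont hx hne (Or.inr rfl) h0
    obtain ⟨A, hA, hx₁A⟩ : x₁ ∈ ⋃₀ 𝒞 := h𝒞 ▸ hx₁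
    obtain ⟨r, hr, hr'⟩ := hfar A hA ⟨x₁, hx₁A⟩
    have hx₂A := mem_of_gfAction_eq_zero hfin hcont (hcompact A hA).1 hr hr' hx₁A hx₂ h0
    obtain ⟨η, hη, hmaps, hη0, hη1, -⟩ := (hcompact A hA).2 x₁ hx₁A x₂ hx₂A
    have hconn : IsPreconnected (gfEmbedding '' (η '' Icc (0 : ℝ) 1)) :=
      (isPreconnected_Icc.image η hη).image _ continuous_gfEmbedding.continuousOn
    refine hconn.subset_connectedComponentIn ?_ ?_ ?_
    · exact ⟨x₁, ⟨0, by simp, hη0⟩, rfl⟩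
    · rintro _ ⟨_, ⟨s, hs, rfl⟩, rfl⟩
      rw [hmemZ, ← h𝒞]
      exact ⟨A, hA, hmaps hs⟩
    · exact ⟨x₂, ⟨1, by simp, hη1⟩, rfl⟩
  · intro hmem
    have hx₁Z : gfEmbedding x₁ ∈ {p | gfPrice E t p = 0} := by
      by_contra hx
      rw [connectedComponentIn_eq_empty hx] at hmem
      exact hmem
    obtain ⟨A, hA, hx₁A⟩ : x₁ ∈ ⋃₀ 𝒞 := h𝒞 ▸ (hmemZ x₁).1 hx₁Z
    obtain ⟨r, hr, hr'⟩ := hfar A hA ⟨x₁, hx₁A⟩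
    have hdist : Continuous fun p : GFPhase X => Metric.infDist p.fst A :=
      (Metric.continuous_infDist_pt A).comp (WithLp.continuous_fst 1 X ℝ≥0)
    have hx₂A : x₂ ∈ A := by
      by_contra hx₂A
      have hx₂Z : x₂ ∈ criticalSet (E t) := (hmemZ x₂).1 (connectedComponentIn_subset _ _ hmem)
      have hdich : ∀ p ∈ {p | gfPrice E t p = 0},
          Metric.infDist p.fst A = 0 ∨ r ≤ Metric.infDist p.fst A := by
        intro p hp
        obtain ⟨x, rfl, hx⟩ := (gfPrice_eq_zero_iff hfin p).1 hp
        by_cases hxA : x ∈ A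
        · exact Or.inl (Metric.infDist_zero_of_mem hxA)
        · exact Or.inr (hr' x hx hxA)
      obtain ⟨p, hp, hp1, hp2⟩ := isPreconnected_connectedComponentIn
        {p : GFPhase X | Metric.infDist p.fst A < r} {p | r / 2 < Metric.infDist p.fst A}
        (isOpen_lt hdist continuous_const) (isOpen_lt continuous_const hdist)
        (fun p hp => (hdich p (connectedComponentIn_subset _ _ hp)).imp
          (fun h => by simpa [h] using hr) fun h => lt_of_lt_of_le (half_lt_self hr) h)
        ⟨_, mem_connectedComponentIn hx₁Z, by
          change Metric.infDist x₁ A < r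
          rwa [Metric.infDist_zero_of_mem hx₁A]⟩
        ⟨_, hmem, (half_lt_self hr).trans_le (hr' x₂ hx₂Z hx₂A)⟩
      have hp1 : Metric.infDist p.fst A < r := hp1
      have hp2 : r / 2 < Metric.infDist p.fst A := hp2
      rcases hdich p (connectedComponentIn_subset _ _ hp) with h | h <;> linarith
    exact gfAction_eq_zero_of_rectifiablyPathConnected hfin hcont hpath hL (hlip t ht)
      (hcompact A hA).2 (fun z hz => h𝒞 ▸ ⟨A, hA, hz⟩) hx₁A hx₂A

/-- Near-optimal curves between points of a compact set have bounded action. Their energy is then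
bounded by that of the end point plus the action, and after a time change their speed is at most
`|∂E_t| + 1`. -/
theorem exists_isCompact_near_optimal {T : ℝ} (hT : 0 < T) {E : ℝ → X → ℝ}
    (hreg : RegularEnergy T E) (hpow : PowerControl T E) (hcoer : UniformlyCoercive T E)
    (hpath : IsPathMetric X) (hlip : SlopeLipschitz T E) {K : Set (GFPhase X)} (hK : IsCompact K) :
    ∃ K' : Set (GFPhase X), IsCompact K' ∧
      ∀ t ∈ Icc 0 T, ∀ p₁ ∈ K, ∀ p₂ ∈ K, ∀ ε : ℝ≥0, 0 < ε →
        ∃ a b γ, γ ∈ gfCurves p₁ p₂ a b ∧ γ '' Icc a b ⊆ K' ∧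
          ∫⁻ s in Ioc a b, (gfPrice E t (γ s) : ℝ≥0∞) ≤
            phaseAction volume (gfCurves (X := X)) (gfPrice E) t p₁ p₂ + ε := by
  have hact := isAction_gfAction hreg hpath hlip
  obtain ⟨L, hL, hlip⟩ := hlip
  have hKx : IsCompact (WithLp.fst '' K) := hK.image (WithLp.continuous_fst 1 X ℝ≥0)
  have hslope : ContinuousOn (fun q : ℝ × X => (descSlope (E q.1) q.2).toReal)
      (Icc 0 T ×ˢ univ) :=
    ENNReal.continuousOn_toReal.comp hreg.continuousOn_slope
      fun q hq => hreg.slope_ne_top q.1 hq.1 _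
  have hsub : ∀ S : Set X, Icc 0 T ×ˢ S ⊆ Icc 0 T ×ˢ univ := fun S =>
    prod_mono le_rfl (subset_univ _)
  obtain ⟨C₁, hC₁⟩ := (isCompact_Icc.prod hKx).bddAbove_image (hreg.continuousOn.mono (hsub _))
  obtain ⟨C₂, hC₂⟩ := (isCompact_Icc.prod hKx).bddAbove_image (hslope.mono (hsub _))
  set D := Metric.diam (WithLp.fst '' K) with hD
  have hD0 : 0 ≤ D := Metric.diam_nonneg
  obtain ⟨C', hC'⟩ := exists_iSup_abs_le hT hreg hpow (C₁ + ((|C₂| + L * D) * D + 1))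
  set S : Set X := {x : X | (⨆ s : Icc (0 : ℝ) T, |E s x|) ≤ C'} with hS
  have hScomp : IsCompact S := hcoer C'
  obtain ⟨M, hM⟩ := (isCompact_Icc.prod hScomp).bddAbove_image (hslope.mono (hsub _))
  refine ⟨K ∪ WithLp.toLp 1 '' (S ×ˢ Icc 0 (M + 1).toNNReal), hK.union
    ((hScomp.prod isCompact_Icc).image (WithLp.prod_continuous_toLp 1 X ℝ≥0)), ?_⟩
  intro t ht p₁ hp₁ p₂ hp₂ ε hε
  have hfin := hreg.slope_ne_top t ht
  have hcont := hreg.continuous_descSlope ht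
  rw [phaseAction_eq_gfAction hfin]
  set c := gfAction E t p₁.fst p₂.fst with hc
  have hcle : c ≤ ENNReal.ofReal ((|C₂| + L * D) * D) := by
    refine (gfAction_le_mul_dist hfin hcont hpath hL.le (hlip t ht) _ _).trans
      (ENNReal.ofReal_le_ofReal ?_)
    have h1 : dist p₁.fst p₂.fst ≤ D :=
      Metric.dist_le_diam_of_mem hKx.isBounded ⟨_, hp₁, rfl⟩ ⟨_, hp₂, rfl⟩
    have h2 : (descSlope (E t) p₁.fst).toReal ≤ |C₂| :=
      (hC₂ ⟨(t, p₁.fst), ⟨ht, ⟨_, hp₁, rfl⟩⟩, rfl⟩).trans (le_abs_self _)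
    gcongr
  -- A curve whose action exceeds the infimum by less than `min 1 (ε / 2)`.
  set e : ℝ≥0 := min 1 (ε / 2) with he
  have he0 : 0 < e := lt_min one_pos (half_pos hε)
  have hlt : c < c + e :=
    ENNReal.lt_add_right (hact.ne_top t ht _ _) (by simpa using he0.ne')
  rw [hc] at hlt
  conv_lhs at hlt => rw [gfAction]
  simp only [iInf_lt_iff] at hlt
  obtain ⟨a, b, φ, ⟨hab, hφ, ha, hb⟩, hdiss⟩ := hlt
  have hdfin : gfDissipation E t φ a b ≠ ∞ := (hdiss.trans_le le_top).ne
  have hdle : gfDissipation E t φ a b ≤ ENNReal.ofReal ((|C₂| + L * D) * D + 1) := by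
    rw [ENNReal.ofReal_add (by positivity) zero_le_one, ENNReal.ofReal_one]
    exact hdiss.le.trans (add_le_add hcle (by exact_mod_cast min_le_left _ _))
  have himS : ∀ s ∈ Icc a b, φ s ∈ S := by
    intro s hs
    refine hC' t ht _ ?_
    have h1 : E t (φ b) ≤ C₁ := by
      rw [hb]; exact hC₁ ⟨(t, p₂.fst), ⟨ht, ⟨_, hp₂, rfl⟩⟩, rfl⟩
    have h2 : E t (φ s) - E t (φ b) ≤ (|C₂| + L * D) * D + 1 := by
      rcases hs.2.eq_or_lt with rfl | hsb
      · rw [sub_self]; positivity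
      · have hac : AbsolutelyContinuousOnInterval φ s b := hφ.mono (by
          rw [uIcc_of_le hs.2, uIcc_of_le hab.le]; exact Icc_subset_Icc_left hs.1)
        refine (hact.energy_le t ht _ _).trans (ENNReal.toReal_le_of_le_ofReal (by positivity) ?_)
        exact (gfAction_le hsb hac).trans ((gfDissipation_mono hs.1 le_rfl).trans hdle)
    linarith
  obtain ⟨ℓ, γ, hγ, hγim, hγle⟩ := exists_mem_gfCurves_lintegral_le hfin hcont hab hφ
    (metricLength_ne_top_of_gfDissipation hdfin) ha hb (ε := (ε / 2 : ℝ≥0)) (by simpa using hε)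
  refine ⟨0, ℓ, γ, hγ, ?_, ?_⟩
  · rintro _ ⟨s, hs, rfl⟩
    obtain ⟨⟨r, hr, hrφ⟩, h | h | h⟩ := hγim s hs
    · exact Or.inl (h ▸ hp₁)
    · exact Or.inl (h ▸ hp₂)
    · refine Or.inr ⟨((γ s).fst, (γ s).snd), ⟨hrφ ▸ himS r hr, zero_le, ?_⟩, rfl⟩
      have hMs : (descSlope (E t) (γ s).fst).toReal ≤ M :=
        hM ⟨(t, (γ s).fst), ⟨ht, hrφ ▸ himS r hr⟩, rfl⟩
      exact NNReal.le_toNNReal_of_coe_le (h.trans (by linarith))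
  · calc ∫⁻ s in Ioc 0 ℓ, (gfPrice E t (γ s) : ℝ≥0∞)
        ≤ gfDissipation E t φ a b + ENNReal.ofReal (ε / 2 : ℝ≥0) :=
          hγle.trans (add_le_add (lintegral_mul_le_gfDissipation E t φ a b) le_rfl)
      _ ≤ (c + (ε / 2 : ℝ≥0)) + (ε / 2 : ℝ≥0) := by
          rw [ENNReal.ofReal_coe_nnreal]
          refine add_le_add (hdiss.le.trans (add_le_add le_rfl ?_)) le_rfl
          exact_mod_cast min_le_right _ _
      _ = c + ε := by
          rw [add_assoc, ← ENNReal.coe_add, add_halves]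

/-- Only the price at the first point has to be small, since the slope is Lipschitz. -/
theorem phaseAction_le_of_dist_le {T : ℝ} {E : ℝ → X → ℝ} (hreg : RegularEnergy T E)
    (hpath : IsPathMetric X) (hlip : SlopeLipschitz T E) {ε : ℝ≥0} (hε : 0 < ε) :
    ∃ l : ℝ, ∃ Q : ℝ≥0, 0 < l ∧ 0 < Q ∧ ∀ t ∈ Icc 0 T, ∀ p₁ p₂ : GFPhase X,
      gfPrice E t p₁ ≤ Q → dist p₁ p₂ ≤ l →
        phaseAction volume (gfCurves (X := X)) (gfPrice E) t p₁ p₂ ≤ ε := by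
  obtain ⟨L, hL, hlip⟩ := hlip
  -- A price of at most `1 / 2` forces the slope to be at most `1`.
  refine ⟨min 1 (ε / (1 + L)), 2⁻¹, lt_min one_pos (by positivity), by simp, ?_⟩
  intro t ht p₁ p₂ h₁ hd
  have hfin := hreg.slope_ne_top t ht
  rw [phaseAction_eq_gfAction hfin]
  refine (gfAction_le_mul_dist hfin (hreg.continuous_descSlope ht) hpath hL.le (hlip t ht)
    _ _).trans ?_
  have hd' : dist p₁.fst p₂.fst ≤ min 1 (ε / (1 + L)) :=
    (WithLp.dist_fst_le p₁ p₂).trans hd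
  have hg : (descSlope (E t) p₁.fst).toReal ≤ 1 := by
    have h2 : 2⁻¹ * (descSlope (E t) p₁.fst).toNNReal ^ 2 ≤ (2⁻¹ : ℝ≥0) * 1 := by
      rw [mul_one]; exact le_self_add.trans h₁
    have h3 := le_of_mul_le_mul_left h2 (by simp)
    exact_mod_cast (pow_le_one_iff_of_nonneg zero_le two_ne_zero).1 h3
  rw [← ENNReal.ofReal_coe_nnreal]
  refine ENNReal.ofReal_le_ofReal ?_
  calc ((descSlope (E t) p₁.fst).toReal + L * dist p₁.fst p₂.fst) * dist p₁.fst p₂.fst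
      ≤ (1 + L * 1) * (ε / (1 + L)) := by
        gcongr
        · exact hd'.trans (min_le_left _ _)
        · exact hd'.trans (min_le_right _ _)
    _ = ε := by field_simp

end QuasistaticEvolution

theorem mainTheorem6 {X : Type*} [MetricSpace X] [LocallyCompactSpace X]
    (T : ℝ) (hT : 0 < T) (E : ℝ → X → ℝ)
    (hreg : QuasistaticEvolution.RegularEnergy T E)
    (hpow : QuasistaticEvolution.PowerControl T E)
    (hcoer : QuasistaticEvolution.UniformlyCoercive T E)
    (hcrit : QuasistaticEvolution.CriticalComponents T E)
    (hpath : QuasistaticEvolution.IsPathMetric X)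
    (hlip : QuasistaticEvolution.SlopeLipschitz T E) :
    (∀ ω : ℝ → X → X, QuasistaticEvolution.IsGFTransitionRule T E ω →
      QuasistaticEvolution.IsCompatible T E (QuasistaticEvolution.gfAction E) ω) ∧
    QuasistaticEvolution.IsGeneratedByCurves T E (QuasistaticEvolution.gfAction E)
      (MeasureTheory.volume : MeasureTheory.Measure ℝ)
      (QuasistaticEvolution.gfCurves (X := X)) QuasistaticEvolution.gfEmbedding
      (QuasistaticEvolution.gfPrice E) := by
  open QuasistaticEvolution in
  have hact := isAction_gfAction hreg hpath hlip
  have : ProperSpace X := properSpace_of_uniformlyCoercive hT hreg hpow hcoer hpath hlip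
  refine ⟨fun ω hω => isCompatible_gfAction hreg hact hω, ?_⟩
  exact
    { isAction := hact
      lt := fun _ _ _ _ _ h => h.1
      congr := fun _ _ _ _ _ _ h hγ => gfCurves_congr h hγ
      endpoints := fun _ _ _ _ _ h => ⟨h.2.1, h.2.2.1⟩
      isClosedEmbedding := isClosedEmbedding_gfEmbedding
      continuousOn_price := continuousOn_gfPrice hreg
      action_eq := fun t ht x₁ x₂ =>
        (phaseAction_eq_gfAction (hreg.slope_ne_top t ht) (gfEmbedding x₁) (gfEmbedding x₂)).symm
      restriction := fun _ _ _ _ _ _ _ hγ has hsb hs => gfCurves_restriction hγ has hsb hs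
      concatenation := fun _ _ _ _ _ _ _ _ hγ hγ' => gfCurves_concatenation hγ hγ'
      shift := fun _ _ _ _ r _ hγ => gfCurves_shift r hγ
      price_eq_zero_iff := fun t ht p => gfPrice_eq_zero_iff (hreg.slope_ne_top t ht) p
      action_eq_zero_iff := fun t ht _ _ hne =>
        gfAction_eq_zero_iff hreg hcrit hpath hlip ht hne
      coercive := fun K hK =>
        exists_isCompact_near_optimal hT hreg hpow hcoer hpath hlip hK
      cheap := fun K _ ε hε => by
        obtain ⟨l, Q, hl, hQ, h⟩ := phaseAction_le_of_dist_le hreg hpath hlip hε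
        exact ⟨l, Q, hl, hQ, fun t ht p₁ _ p₂ _ h₁ _ hd => h t ht p₁ p₂ h₁ hd⟩ }
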